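/- Work over $\mathbb{C}$. Identify $\mathbb{P}^{14}$ with the projective space of nonzero symmetric $5\times 5$ matrices up to scalars, let $\mathcal{H}=\{[A]\in\mathbb{P}^{14} : \det A=0\}$ be the symmetric determinantal hypersurface, and let $$\mathcal{U}=\{([x],[A])\in\mathbb{P}^4\times\mathcal{H} : Ax=0\},$$ with projections $\pi_1:\mathcal{U}\to\mathbb{P}^4$ and $\pi_2:\mathcal{U}\to\mathcal{H}$. Put $\mathcal{L}=\pi_1^*\mathcal{O}_{\mathbb{P}^4}(1)$ and $\mathcal{M}=\pi_2^*\mathcal{O}_{\mathcal{H}}(1)$, where $\mathcal{O}_{\mathcal{H}}(1)$ is the restriction of $\mathcal{O}_{\mathbb{P}^{14}}(1)$, and let $\mathcal{E}\subset\mathcal{U}$ be the exceptional locus of $\pi_2$ (the set of points at which $\pi_2$ is not a local isomorphism), with its reduced structure. Then $\mathcal{E}$ is an effective Cartier divisor on $\mathcal{U}$, and its class satisfies $$\mathcal{E}=4\mathcal{M}-2\mathcal{L}\quad\text{in }\operatorname{Pic}\mathcal{U},$$ that is, $\mathcal{O}_{\mathcal{U}}(\mathcal{E})\cong\mathcal{M}^{\otimes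 4}\otimes\mathcal{L}^{\otimes(-2)}$. -/

import Mathlib

open Topology

/-! ## Spaces with functions

Complex algebraic varieties are treated in the classical way: sets of complex points with the
Zariski topology and the sheaf of regular functions, a sheaf of algebras of `ℂ`-valued functions.
The sheaf is recorded by saying when a function is regular at a point; the sections over an open
set `V` are the functions on `V` that are regular at every point of `V`. -/

/-- A topological space with a sheaf of local `ℂ`-algebras of `ℂ`-valued functions. -/
structure SpaceWithFunctions where
  Pt : Type
  [top : TopologicalSpace Pt]
  /-- `RegAt f x`: the function `f` is regular in a neighbourhood of `x`. Only the germ of `f` at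
  `x` matters. -/
  RegAt : (Pt → ℂ) → Pt → Prop
  regAt_congr : ∀ {f g : Pt → ℂ} {x : Pt}, f =ᶠ[𝓝 x] g → RegAt f x → RegAt g x
  regAt_const : ∀ (c : ℂ) (x : Pt), RegAt (fun _ => c) x
  regAt_add : ∀ {f g : Pt → ℂ} {x : Pt}, RegAt f x → RegAt g x → RegAt (fun y => f y + g y) x
  regAt_mul : ∀ {f g : Pt → ℂ} {x : Pt}, RegAt f x → RegAt g x → RegAt (fun y => f y * g y) x
  regAt_inv : ∀ {f : Pt → ℂ} {x : Pt}, RegAt f x → f x ≠ 0 → RegAt (fun y => (f y)⁻¹) x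
  regAt_eventually : ∀ {f : Pt → ℂ} {x : Pt}, RegAt f x → ∀ᶠ y in 𝓝 x, RegAt f y
  ne_zero_eventually : ∀ {f : Pt → ℂ} {x : Pt}, RegAt f x → f x ≠ 0 → ∀ᶠ y in 𝓝 x, f y ≠ 0

namespace SpaceWithFunctions

instance (X : SpaceWithFunctions) : TopologicalSpace X.Pt := X.top

/-- The map `φ` is a morphism near `x`, as far as the point `x` is concerned: it is continuous at
`x` and pulls regular germs at `φ x` back to regular germs at `x`. -/
def IsMorphismAt {X Y : SpaceWithFunctions} (φ : X.Pt → Y.Pt) (x : X.Pt) : Prop :=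
  ContinuousAt φ x ∧ ∀ f : Y.Pt → ℂ, Y.RegAt f (φ x) → X.RegAt (fun y => f (φ y)) x

/-- Morphisms of spaces with functions. -/
structure Hom (X Y : SpaceWithFunctions) where
  toFun : X.Pt → Y.Pt
  isMorphismAt : ∀ x, IsMorphismAt toFun x

/-- `φ` is a local isomorphism at `x`: it restricts to an isomorphism from an open neighbourhood
`V` of `x` onto an open subset `W` of the target. -/
def IsLocalIsoAt {X Y : SpaceWithFunctions} (φ : Hom X Y) (x : X.Pt) : Prop :=
  ∃ (V : Set X.Pt) (W : Set Y.Pt) (ψ : Y.Pt → X.Pt), IsOpen V ∧ IsOpen W ∧ x ∈ V ∧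
    Set.MapsTo φ.toFun V W ∧ Set.MapsTo ψ W V ∧ Set.InvOn ψ φ.toFun V W ∧
    ∀ y ∈ W, IsMorphismAt ψ y

/-- The exceptional locus of a morphism: the points at which it is not a local isomorphism. -/
def exceptionalLocus {X Y : SpaceWithFunctions} (φ : Hom X Y) : Set X.Pt :=
  {x | ¬ IsLocalIsoAt φ x}

/-- The structure of a space with functions induced on a subset: the subspace topology, with
the functions that are locally restrictions of regular functions. -/
def restrict (X : SpaceWithFunctions) (Z : Set X.Pt) : SpaceWithFunctions where
  Pt := Z
  RegAt f x := ∃ g : X.Pt → ℂ, X.RegAt g x ∧ ∀ᶠ y : Z in 𝓝 x, f y = g y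
  regAt_congr := by
    rintro f f' x h ⟨g, hg, hf⟩
    refine ⟨g, hg, ?_⟩
    filter_upwards [h, hf] with y h1 h2
    rw [← h1, h2]
  regAt_const c x := ⟨fun _ => c, X.regAt_const c x, Filter.Eventually.of_forall fun _ => rfl⟩
  regAt_add := by
    rintro f f' x ⟨g, hg, hf⟩ ⟨g', hg', hf'⟩
    refine ⟨_, X.regAt_add hg hg', ?_⟩
    filter_upwards [hf, hf'] with y h1 h2
    rw [h1, h2]
  regAt_mul := by
    rintro f f' x ⟨g, hg, hf⟩ ⟨g', hg', hf'⟩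
    refine ⟨_, X.regAt_mul hg hg', ?_⟩
    filter_upwards [hf, hf'] with y h1 h2
    rw [h1, h2]
  regAt_inv := by
    rintro f x ⟨g, hg, hf⟩ hx
    have h0 : f x = g x := hf.self_of_nhds
    refine ⟨_, X.regAt_inv hg (h0 ▸ hx), ?_⟩
    filter_upwards [hf] with y h1
    rw [h1]
  regAt_eventually := by
    rintro f x ⟨g, hg, hf⟩
    have h1 : ∀ᶠ y : Z in 𝓝 x, X.RegAt g y :=
      continuous_subtype_val.continuousAt.eventually (X.regAt_eventually hg)
    filter_upwards [h1, hf.eventually_nhds] with y h2 h3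
    exact ⟨g, h2, h3⟩
  ne_zero_eventually := by
    rintro f x ⟨g, hg, hf⟩ hx
    have h0 : f x = g x := hf.self_of_nhds
    have h1 : ∀ᶠ y : Z in 𝓝 x, g y ≠ 0 :=
      continuous_subtype_val.continuousAt.eventually (X.ne_zero_eventually hg (h0 ▸ hx))
    filter_upwards [h1, hf] with y h2 h3
    rwa [h3]

/-- The inclusion of a subset with its induced structure. -/
def incl (X : SpaceWithFunctions) (Z : Set X.Pt) : Hom (X.restrict Z) X where
  toFun x := x.1
  isMorphismAt _ := ⟨continuous_subtype_val.continuousAt,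
    fun f hf => ⟨f, hf, Filter.Eventually.of_forall fun _ => rfl⟩⟩

/-! ## Line bundles and the Picard group -/

/-- An (algebraic) line bundle, given by an open cover and transition functions. Its sections are
the families of regular functions `s i` on `V i` with `s i = g i j * s j` on `V i ∩ V j`. -/
structure LineBundle (X : SpaceWithFunctions) where
  ι : Type
  V : ι → Set X.Pt
  isOpen : ∀ i, IsOpen (V i)
  cover : ∀ x, ∃ i, x ∈ V i
  g : ι → ι → X.Pt → ℂ
  regAt : ∀ i j, ∀ x ∈ V i ∩ V j, X.RegAt (g i j) x
  ne_zero : ∀ i j, ∀ x ∈ V i ∩ V j, g i j x ≠ 0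
  cocycle : ∀ i j k, ∀ x ∈ V i ∩ V j ∩ V k, g i j x * g j k x = g i k x

namespace LineBundle

variable {X Y : SpaceWithFunctions}

/-- An isomorphism of line bundles, in terms of the trivialisations: it sends the section with
local expressions `s i` to the section with local expressions `φ i j * s i` on `V i ∩ V' j`. -/
structure Iso (L L' : LineBundle X) where
  φ : L.ι → L'.ι → X.Pt → ℂ
  regAt : ∀ i j, ∀ x ∈ L.V i ∩ L'.V j, X.RegAt (φ i j) x
  ne_zero : ∀ i j, ∀ x ∈ L.V i ∩ L'.V j, φ i j x ≠ 0
  compat : ∀ i k j l, ∀ x ∈ L.V i ∩ L.V k ∩ (L'.V j ∩ L'.V l),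
    φ i j x * L.g i k x = L'.g j l x * φ k l x

theorem g_self (L : LineBundle X) {i : L.ι} {x : X.Pt} (hx : x ∈ L.V i) : L.g i i x = 1 := by
  have h := L.cocycle i i i x ⟨⟨hx, hx⟩, hx⟩
  have h0 := L.ne_zero i i x ⟨hx, hx⟩
  exact mul_left_cancel₀ h0 (by rw [h, mul_one])

theorem Iso.nonempty_refl (L : LineBundle X) : Nonempty (Iso L L) :=
  ⟨{ φ := fun i j => L.g j i
     regAt := fun i j x hx => L.regAt j i x hx.symm
     ne_zero := fun i j x hx => L.ne_zero j i x hx.symm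
     compat := fun i k j l x hx => by
      rw [L.cocycle j i k x ⟨⟨hx.2.1, hx.1.1⟩, hx.1.2⟩,
        L.cocycle j l k x ⟨⟨hx.2.1, hx.2.2⟩, hx.1.2⟩] }⟩

theorem Iso.nonempty_symm {L L' : LineBundle X} (h : Nonempty (Iso L L')) :
    Nonempty (Iso L' L) := by
  obtain ⟨e⟩ := h
  refine ⟨{ φ := fun j i x => (e.φ i j x)⁻¹
            regAt := fun j i x hx => X.regAt_inv (e.regAt i j x hx.symm) (e.ne_zero i j x hx.symm)
            ne_zero := fun j i x hx => inv_ne_zero (e.ne_zero i j x hx.symm)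
            compat := ?_ }⟩
  intro j l i k x hx
  have h1 := e.ne_zero i j x ⟨hx.2.1, hx.1.1⟩
  have h2 := e.ne_zero k l x ⟨hx.2.2, hx.1.2⟩
  have h3 := e.compat i k j l x ⟨hx.2, hx.1⟩
  field_simp
  linear_combination -h3

theorem Iso.nonempty_trans {L L' L'' : LineBundle X} (h : Nonempty (Iso L L'))
    (h' : Nonempty (Iso L' L'')) : Nonempty (Iso L L'') := by
  obtain ⟨e⟩ := h
  obtain ⟨e'⟩ := h'
  choose c hc using L'.cover
  have key : ∀ i k, ∀ x ∈ L.V i ∩ L''.V k, ∀ j j', x ∈ L'.V j → x ∈ L'.V j' →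
      e.φ i j x * e'.φ j k x = e.φ i j' x * e'.φ j' k x := by
    intro i k x hx j j' hj hj'
    have h1 := e.compat i i j j' x ⟨⟨hx.1, hx.1⟩, hj, hj'⟩
    have h2 := e'.compat j j' k k x ⟨⟨hj, hj'⟩, hx.2, hx.2⟩
    rw [L.g_self hx.1, mul_one] at h1
    rw [L''.g_self hx.2, one_mul] at h2
    rw [h1, ← h2]; ring
  refine ⟨{ φ := fun i k x => e.φ i (c x) x * e'.φ (c x) k x
            regAt := ?_, ne_zero := ?_, compat := ?_ }⟩
  · intro i k x hx
    refine X.regAt_congr ?_ (X.regAt_mul (e.regAt i (c x) x ⟨hx.1, hc x⟩)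
      (e'.regAt (c x) k x ⟨hc x, hx.2⟩))
    filter_upwards [(L.isOpen i).mem_nhds hx.1, (L''.isOpen k).mem_nhds hx.2,
      (L'.isOpen (c x)).mem_nhds (hc x)] with y h1 h2 h3
    exact key i k y ⟨h1, h2⟩ _ _ h3 (hc y)
  · intro i k x hx
    exact mul_ne_zero (e.ne_zero _ _ x ⟨hx.1, hc x⟩) (e'.ne_zero _ _ x ⟨hc x, hx.2⟩)
  · intro i k j l x hx
    have h1 := e.compat i k (c x) (c x) x ⟨hx.1, hc x, hc x⟩
    have h2 := e'.compat (c x) (c x) j l x ⟨⟨hc x, hc x⟩, hx.2⟩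
    rw [L'.g_self (hc x), one_mul] at h1
    rw [L'.g_self (hc x), mul_one] at h2
    linear_combination e'.φ (c x) j x * h1 + e.φ k (c x) x * h2

/-- The trivial line bundle. -/
def trivial (X : SpaceWithFunctions) : LineBundle X where
  ι := Unit
  V _ := Set.univ
  isOpen _ := isOpen_univ
  cover _ := ⟨(), Set.mem_univ _⟩
  g _ _ _ := 1
  regAt _ _ x _ := X.regAt_const 1 x
  ne_zero _ _ _ _ := one_ne_zero
  cocycle _ _ _ _ _ := one_mul 1

/-- The tensor product of two line bundles. -/
def tensor (L L' : LineBundle X) : LineBundle X where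
  ι := L.ι × L'.ι
  V i := L.V i.1 ∩ L'.V i.2
  isOpen i := (L.isOpen i.1).inter (L'.isOpen i.2)
  cover x := by
    obtain ⟨i, hi⟩ := L.cover x
    obtain ⟨j, hj⟩ := L'.cover x
    exact ⟨(i, j), hi, hj⟩
  g i j x := L.g i.1 j.1 x * L'.g i.2 j.2 x
  regAt i j x hx := X.regAt_mul (L.regAt _ _ x ⟨hx.1.1, hx.2.1⟩) (L'.regAt _ _ x ⟨hx.1.2, hx.2.2⟩)
  ne_zero i j x hx := mul_ne_zero (L.ne_zero _ _ x ⟨hx.1.1, hx.2.1⟩)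
    (L'.ne_zero _ _ x ⟨hx.1.2, hx.2.2⟩)
  cocycle i j k x hx := by
    rw [← L.cocycle i.1 j.1 k.1 x ⟨⟨hx.1.1.1, hx.1.2.1⟩, hx.2.1⟩,
      ← L'.cocycle i.2 j.2 k.2 x ⟨⟨hx.1.1.2, hx.1.2.2⟩, hx.2.2⟩]
    ring

/-- The dual line bundle. -/
noncomputable def dual (L : LineBundle X) : LineBundle X where
  ι := L.ι
  V := L.V
  isOpen := L.isOpen
  cover := L.cover
  g i j x := (L.g i j x)⁻¹
  regAt i j x hx := X.regAt_inv (L.regAt i j x hx) (L.ne_zero i j x hx)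
  ne_zero i j x hx := inv_ne_zero (L.ne_zero i j x hx)
  cocycle i j k x hx := by rw [← L.cocycle i j k x hx, mul_inv]

/-- The pull-back of a line bundle under a morphism. -/
def pullback (φ : Hom X Y) (L : LineBundle Y) : LineBundle X where
  ι := L.ι
  V i := φ.toFun ⁻¹' L.V i
  isOpen i := (continuous_iff_continuousAt.2 fun x => (φ.isMorphismAt x).1).isOpen_preimage _
    (L.isOpen i)
  cover x := L.cover (φ.toFun x)
  g i j x := L.g i j (φ.toFun x)
  regAt i j x hx := (φ.isMorphismAt x).2 _ (L.regAt i j _ hx)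
  ne_zero i j x hx := L.ne_zero i j _ hx
  cocycle i j k x hx := L.cocycle i j k _ hx

theorem Iso.nonempty_tensor {L₁ L₁' L₂ L₂' : LineBundle X} (h₁ : Nonempty (Iso L₁ L₁'))
    (h₂ : Nonempty (Iso L₂ L₂')) : Nonempty (Iso (L₁.tensor L₂) (L₁'.tensor L₂')) := by
  obtain ⟨e⟩ := h₁
  obtain ⟨f⟩ := h₂
  refine ⟨{ φ := fun i j x => e.φ i.1 j.1 x * f.φ i.2 j.2 x
            regAt := fun i j x hx => X.regAt_mul (e.regAt _ _ x ⟨hx.1.1, hx.2.1⟩)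
              (f.regAt _ _ x ⟨hx.1.2, hx.2.2⟩)
            ne_zero := fun i j x hx => mul_ne_zero (e.ne_zero _ _ x ⟨hx.1.1, hx.2.1⟩)
              (f.ne_zero _ _ x ⟨hx.1.2, hx.2.2⟩)
            compat := ?_ }⟩
  rintro ⟨i, i'⟩ ⟨k, k'⟩ ⟨j, j'⟩ ⟨l, l'⟩ x ⟨⟨⟨a, a'⟩, b, b'⟩, ⟨c, c'⟩, d, d'⟩
  have h1 := e.compat i k j l x ⟨⟨a, b⟩, c, d⟩
  have h2 := f.compat i' k' j' l' x ⟨⟨a', b'⟩, c', d'⟩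
  simp only [tensor]
  linear_combination (f.φ i' j' x * L₂.g i' k' x) * h1 + (L₁'.g j l x * e.φ k l x) * h2

theorem Iso.nonempty_dual {L L' : LineBundle X} (h : Nonempty (Iso L L')) :
    Nonempty (Iso L.dual L'.dual) := by
  obtain ⟨e⟩ := h
  refine ⟨{ φ := fun i j x => (e.φ i j x)⁻¹
            regAt := fun i j x hx => X.regAt_inv (e.regAt i j x hx) (e.ne_zero i j x hx)
            ne_zero := fun i j x hx => inv_ne_zero (e.ne_zero i j x hx)
            compat := ?_ }⟩
  intro i k j l x hx
  simp only [dual]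
  rw [← mul_inv, ← mul_inv, e.compat i k j l x hx]

theorem Iso.nonempty_pullback (φ : Hom X Y) {L L' : LineBundle Y} (h : Nonempty (Iso L L')) :
    Nonempty (Iso (L.pullback φ) (L'.pullback φ)) := by
  obtain ⟨e⟩ := h
  exact ⟨{ φ := fun i j x => e.φ i j (φ.toFun x)
           regAt := fun i j x hx => (φ.isMorphismAt x).2 _ (e.regAt i j _ hx)
           ne_zero := fun i j x hx => e.ne_zero i j _ hx
           compat := fun i k j l x hx => e.compat i k j l _ hx }⟩

/-- Line bundles are isomorphic if the cover of the first refines that of the second and the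
transition functions of the first are restrictions of those of the second. -/
theorem Iso.nonempty_of_map {L L' : LineBundle X} (m : L.ι → L'.ι)
    (hV : ∀ i, L.V i ⊆ L'.V (m i))
    (hg : ∀ i j, ∀ x ∈ L.V i ∩ L.V j, L.g i j x = L'.g (m i) (m j) x) :
    Nonempty (Iso L L') := by
  refine ⟨{ φ := fun i j => L'.g j (m i)
            regAt := fun i j x hx => L'.regAt _ _ x ⟨hx.2, hV i hx.1⟩
            ne_zero := fun i j x hx => L'.ne_zero _ _ x ⟨hx.2, hV i hx.1⟩
            compat := ?_ }⟩
  intro i k j l x hx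
  rw [hg i k x hx.1, L'.cocycle j (m i) (m k) x ⟨⟨hx.2.1, hV i hx.1.1⟩, hV k hx.1.2⟩,
    L'.cocycle j l (m k) x ⟨hx.2, hV k hx.1.2⟩]

/-- Isomorphism of line bundles as an equivalence relation. -/
instance setoid (X : SpaceWithFunctions) : Setoid (LineBundle X) where
  r L L' := Nonempty (Iso L L')
  iseqv := ⟨Iso.nonempty_refl, Iso.nonempty_symm, Iso.nonempty_trans⟩

end LineBundle

/-- The Picard group: isomorphism classes of line bundles. -/
def Pic (X : SpaceWithFunctions) : Type 1 := Quotient (LineBundle.setoid X)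

/-- The class of a line bundle in the Picard group. -/
def LineBundle.toPic {X : SpaceWithFunctions} (L : LineBundle X) : Pic X :=
  Quotient.mk (LineBundle.setoid X) L

instance (X : SpaceWithFunctions) : Zero (Pic X) := ⟨(LineBundle.trivial X).toPic⟩

instance (X : SpaceWithFunctions) : Add (Pic X) :=
  ⟨Quotient.map₂ LineBundle.tensor
    (fun _ _ h₁ _ _ h₂ => LineBundle.Iso.nonempty_tensor h₁ h₂)⟩

noncomputable instance (X : SpaceWithFunctions) : Neg (Pic X) :=
  ⟨Quotient.map LineBundle.dual (fun _ _ h => LineBundle.Iso.nonempty_dual h)⟩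

/-- The Picard group, written additively: the sum is the tensor product, the negative is the
dual. -/
noncomputable instance (X : SpaceWithFunctions) : AddCommGroup (Pic X) where
  nsmul := nsmulRec
  zsmul := zsmulRec
  add_assoc := by
    rintro ⟨L⟩ ⟨L'⟩ ⟨L''⟩
    exact Quotient.sound (LineBundle.Iso.nonempty_of_map (fun i => (i.1.1, (i.1.2, i.2)))
      (fun i x hx => ⟨hx.1.1, hx.1.2, hx.2⟩) (fun i j x _ => mul_assoc _ _ _))
  zero_add := by
    rintro ⟨L⟩
    exact Quotient.sound (LineBundle.Iso.nonempty_of_map (fun i => i.2)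
      (fun i x hx => hx.2) (fun i j x _ => one_mul _))
  add_zero := by
    rintro ⟨L⟩
    exact Quotient.sound (LineBundle.Iso.nonempty_of_map (fun i => i.1)
      (fun i x hx => hx.1) (fun i j x _ => mul_one _))
  add_comm := by
    rintro ⟨L⟩ ⟨L'⟩
    exact Quotient.sound (LineBundle.Iso.nonempty_of_map (fun i => (i.2, i.1))
      (fun i x hx => ⟨hx.2, hx.1⟩) (fun i j x _ => mul_comm _ _))
  neg_add_cancel := by
    rintro ⟨L⟩
    refine Quotient.sound ⟨{
      φ := fun i _ => L.g i.1 i.2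
      regAt := fun _ _ x hx => L.regAt _ _ x hx.1
      ne_zero := fun _ _ x hx => L.ne_zero _ _ x hx.1
      compat := ?_ }⟩
    rintro ⟨i, i'⟩ ⟨k, k'⟩ j l x ⟨⟨⟨a, a'⟩, b, b'⟩, -⟩
    have h1 := L.cocycle i i' k' x ⟨⟨a, a'⟩, b'⟩
    have h2 := L.cocycle i k k' x ⟨⟨a, b⟩, b'⟩
    have h3 := L.ne_zero i k x ⟨a, b⟩
    change L.g i i' x * ((L.g i k x)⁻¹ * L.g i' k' x) = 1 * L.g k k' x
    field_simp
    rw [h1, h2]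

/-! ## Divisors -/

/-- Near `x`, the function `f` generates freely the ideal of regular germs at `x` that vanish
on `Z`. -/
def GeneratesIdealAt {X : SpaceWithFunctions} (Z : Set X.Pt) (f : X.Pt → ℂ) (x : X.Pt) : Prop :=
  X.RegAt f x ∧
  (∀ h : X.Pt → ℂ, X.RegAt h x →
    ((∀ᶠ y in 𝓝 x, y ∈ Z → h y = 0) ↔ ∃ q, X.RegAt q x ∧ ∀ᶠ y in 𝓝 x, h y = q y * f y)) ∧
  ∀ q : X.Pt → ℂ, X.RegAt q x → (∀ᶠ y in 𝓝 x, q y * f y = 0) → ∀ᶠ y in 𝓝 x, q y = 0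

/-- The closed subset `Z`, with its reduced structure, is an effective Cartier divisor: locally
its ideal is generated by one function that is not a zero divisor. -/
def IsReducedDivisor {X : SpaceWithFunctions} (Z : Set X.Pt) : Prop :=
  ∀ x, ∃ (V : Set X.Pt) (f : X.Pt → ℂ), IsOpen V ∧ x ∈ V ∧ ∀ y ∈ V, GeneratesIdealAt Z f y

theorem GeneratesIdealAt.exists_quotient {X : SpaceWithFunctions} {Z : Set X.Pt}
    {f f' : X.Pt → ℂ} {x : X.Pt} (h : GeneratesIdealAt Z f x) (h' : GeneratesIdealAt Z f' x) :
    ∃ q, X.RegAt q x ∧ ∀ᶠ y in 𝓝 x, f y = q y * f' y := by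
  refine (h'.2.1 f h.1).1 ((h.2.1 f h.1).2 ⟨fun _ => 1, X.regAt_const 1 x, ?_⟩)
  exact Filter.Eventually.of_forall fun y => (one_mul _).symm

theorem GeneratesIdealAt.eventually_eq {X : SpaceWithFunctions} {Z : Set X.Pt}
    {f q q' : X.Pt → ℂ} {x : X.Pt} (h : GeneratesIdealAt Z f x) (hq : X.RegAt q x)
    (hq' : X.RegAt q' x) (e : ∀ᶠ y in 𝓝 x, q y * f y = q' y * f y) :
    ∀ᶠ y in 𝓝 x, q y = q' y := by
  have h1 := h.2.2 (fun y => q y + (-1) * q' y)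
    (X.regAt_add hq (X.regAt_mul (X.regAt_const (-1) x) hq')) (by
      filter_upwards [e] with y hy
      linear_combination hy)
  filter_upwards [h1] with y hy
  linear_combination hy

open Classical in
/-- The value at `x` of the regular function `f / f'`, for two local equations `f`, `f'` of the
same divisor (also at the zeros of `f'`). -/
noncomputable def quotientAt (X : SpaceWithFunctions) (f f' : X.Pt → ℂ) (x : X.Pt) : ℂ :=
  if h : ∃ q, X.RegAt q x ∧ ∀ᶠ y in 𝓝 x, f y = q y * f' y then h.choose x else 0

theorem quotientAt_eq {X : SpaceWithFunctions} {Z : Set X.Pt} {f f' q : X.Pt → ℂ} {x : X.Pt}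
    (h' : GeneratesIdealAt Z f' x) (hq : X.RegAt q x)
    (e : ∀ᶠ y in 𝓝 x, f y = q y * f' y) : quotientAt X f f' x = q x := by
  have h : ∃ q, X.RegAt q x ∧ ∀ᶠ y in 𝓝 x, f y = q y * f' y := ⟨q, hq, e⟩
  rw [quotientAt, dif_pos h]
  refine (h'.eventually_eq h.choose_spec.1 hq ?_).self_of_nhds
  filter_upwards [e, h.choose_spec.2] with y h1 h2
  rw [← h1, ← h2]

theorem quotientAt_spec {X : SpaceWithFunctions} {Z V : Set X.Pt} {f f' : X.Pt → ℂ} {x : X.Pt}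
    (hV : IsOpen V) (hx : x ∈ V) (h : ∀ y ∈ V, GeneratesIdealAt Z f y)
    (h' : ∀ y ∈ V, GeneratesIdealAt Z f' y) :
    X.RegAt (quotientAt X f f') x ∧ ∀ᶠ y in 𝓝 x, f y = quotientAt X f f' y * f' y := by
  obtain ⟨q, hq, e⟩ := (h x hx).exists_quotient (h' x hx)
  have key : ∀ᶠ y in 𝓝 x, q y = quotientAt X f f' y := by
    filter_upwards [hV.mem_nhds hx, X.regAt_eventually hq, e.eventually_nhds] with y h1 h2 h3
    exact (quotientAt_eq (h' y h1) h2 h3).symm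
  refine ⟨X.regAt_congr key hq, ?_⟩
  filter_upwards [key, e] with y h1 h2
  rw [h2, h1]

theorem quotientAt_mul {X : SpaceWithFunctions} {Z V : Set X.Pt} {f f' f'' : X.Pt → ℂ} {x : X.Pt}
    (hV : IsOpen V) (hx : x ∈ V) (h : ∀ y ∈ V, GeneratesIdealAt Z f y)
    (h' : ∀ y ∈ V, GeneratesIdealAt Z f' y) (h'' : ∀ y ∈ V, GeneratesIdealAt Z f'' y) :
    quotientAt X f f' x * quotientAt X f' f'' x = quotientAt X f f'' x := by
  obtain ⟨h1, e1⟩ := quotientAt_spec hV hx h h'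
  obtain ⟨h2, e2⟩ := quotientAt_spec hV hx h' h''
  refine (quotientAt_eq (h'' x hx) (X.regAt_mul h1 h2) ?_).symm
  filter_upwards [e1, e2] with y h3 h4
  rw [h3, mul_assoc, ← h4]

theorem quotientAt_self {X : SpaceWithFunctions} {Z : Set X.Pt} {f : X.Pt → ℂ} {x : X.Pt}
    (h : GeneratesIdealAt Z f x) : quotientAt X f f x = 1 :=
  quotientAt_eq (q := fun _ => 1) h (X.regAt_const 1 x)
    (Filter.Eventually.of_forall fun _ => (one_mul _).symm)

/-- The line bundle `𝒪(Z)` of a reduced divisor `Z`: if `f i` are local equations of `Z`, its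
transition functions are `f i / f j`. Other local equations give an isomorphic line bundle. -/
noncomputable def IsReducedDivisor.lineBundle {X : SpaceWithFunctions} {Z : Set X.Pt}
    (hZ : IsReducedDivisor Z) : LineBundle X where
  ι := X.Pt
  V i := (hZ i).choose
  isOpen i := (hZ i).choose_spec.choose_spec.1
  cover x := ⟨x, (hZ x).choose_spec.choose_spec.2.1⟩
  g i j := quotientAt X (hZ i).choose_spec.choose (hZ j).choose_spec.choose
  regAt i j x hx :=
    (quotientAt_spec ((hZ i).choose_spec.choose_spec.1.inter (hZ j).choose_spec.choose_spec.1) hx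
      (fun y hy => (hZ i).choose_spec.choose_spec.2.2 y hy.1)
      (fun y hy => (hZ j).choose_spec.choose_spec.2.2 y hy.2)).1
  ne_zero i j x hx h0 := by
    have h1 := quotientAt_mul
      ((hZ i).choose_spec.choose_spec.1.inter (hZ j).choose_spec.choose_spec.1) hx
      (fun y hy => (hZ i).choose_spec.choose_spec.2.2 y hy.1)
      (fun y hy => (hZ j).choose_spec.choose_spec.2.2 y hy.2)
      (fun y hy => (hZ i).choose_spec.choose_spec.2.2 y hy.1)
    rw [h0, zero_mul, quotientAt_self ((hZ i).choose_spec.choose_spec.2.2 x hx.1)] at h1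
    exact zero_ne_one h1
  cocycle i j k x hx := quotientAt_mul
      (((hZ i).choose_spec.choose_spec.1.inter (hZ j).choose_spec.choose_spec.1).inter
        (hZ k).choose_spec.choose_spec.1) hx
      (fun y hy => (hZ i).choose_spec.choose_spec.2.2 y hy.1.1)
      (fun y hy => (hZ j).choose_spec.choose_spec.2.2 y hy.1.2)
      (fun y hy => (hZ k).choose_spec.choose_spec.2.2 y hy.2)

/-! ## Projective spaces and their products -/

/-- The Zariski topology on a set `X` whose points have coordinate vectors `rep x`, with coordinates
graded by `w`: the open sets are generated by the non-vanishing loci of homogeneous polynomials. -/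
abbrev coordinateTopology {X ι M : Type} [AddCommMonoid M] (w : ι → M) (rep : X → ι → ℂ) :
    TopologicalSpace X :=
  TopologicalSpace.generateFrom
    {D | ∃ (F : MvPolynomial ι ℂ) (m : M), F.IsWeightedHomogeneous w m ∧
      D = {x | MvPolynomial.eval (rep x) F ≠ 0}}

theorem isOpen_coordinateTopology {X ι M : Type} [AddCommMonoid M] (w : ι → M)
    (rep : X → ι → ℂ) {F : MvPolynomial ι ℂ} {m : M} (hF : F.IsWeightedHomogeneous w m) :
    @IsOpen X (coordinateTopology w rep) {x | MvPolynomial.eval (rep x) F ≠ 0} :=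
  TopologicalSpace.isOpen_generateFrom_of_mem ⟨F, m, hF, rfl⟩

/-- The space with functions on a set `X` with such coordinates: the regular functions are locally
quotients of two homogeneous polynomials of the same degree in the coordinates. For (products of)
projective spaces, neither the open sets nor these quotients depend on the chosen coordinate
vectors. -/
def ofCoordinates {X ι M : Type} [AddCommMonoid M] (w : ι → M) (rep : X → ι → ℂ) :
    SpaceWithFunctions where
  Pt := X
  top := coordinateTopology w rep
  RegAt f x := ∃ (F G : MvPolynomial ι ℂ) (m : M), F.IsWeightedHomogeneous w m ∧
    G.IsWeightedHomogeneous w m ∧ MvPolynomial.eval (rep x) G ≠ 0 ∧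
    ∀ᶠ y in @nhds X (coordinateTopology w rep) x,
      f y = MvPolynomial.eval (rep y) F / MvPolynomial.eval (rep y) G
  regAt_congr := by
    rintro f f' x h ⟨F, G, m, hF, hG, h0, hf⟩
    refine ⟨F, G, m, hF, hG, h0, ?_⟩
    filter_upwards [h, hf] with y h1 h2
    rw [← h1, h2]
  regAt_const c x := ⟨MvPolynomial.C c, 1, 0, MvPolynomial.isWeightedHomogeneous_C w c,
    MvPolynomial.isWeightedHomogeneous_one ℂ w, by simp, Filter.Eventually.of_forall (by simp)⟩
  regAt_add := by
    let := coordinateTopology w rep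
    rintro f f' x ⟨F, G, m, hF, hG, h0, hf⟩ ⟨F', G', m', hF', hG', h0', hf'⟩
    have hD : ∀ᶠ y in 𝓝 x, MvPolynomial.eval (rep y) G ≠ 0 :=
      (isOpen_coordinateTopology w rep hG).mem_nhds h0
    have hD' : ∀ᶠ y in 𝓝 x, MvPolynomial.eval (rep y) G' ≠ 0 :=
      (isOpen_coordinateTopology w rep hG').mem_nhds h0'
    refine ⟨F * G' + G * F', G * G', m + m', (hF.mul hG').add (hG.mul hF'), hG.mul hG',
      by simp [h0, h0'], ?_⟩
    filter_upwards [hf, hf', hD, hD'] with y h1 h2 h3 h4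
    rw [h1, h2, div_add_div _ _ h3 h4]
    simp
  regAt_mul := by
    let := coordinateTopology w rep
    rintro f f' x ⟨F, G, m, hF, hG, h0, hf⟩ ⟨F', G', m', hF', hG', h0', hf'⟩
    refine ⟨F * F', G * G', m + m', hF.mul hF', hG.mul hG', by simp [h0, h0'], ?_⟩
    filter_upwards [hf, hf'] with y h1 h2
    rw [h1, h2, div_mul_div_comm]
    simp
  regAt_inv := by
    let := coordinateTopology w rep
    rintro f x ⟨F, G, m, hF, hG, h0, hf⟩ hx
    refine ⟨G, F, m, hG, hF, ?_, ?_⟩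
    · intro h
      rw [hf.self_of_nhds, h, zero_div] at hx
      exact hx rfl
    · filter_upwards [hf] with y h1
      rw [h1, inv_div]
  regAt_eventually := by
    let := coordinateTopology w rep
    rintro f x ⟨F, G, m, hF, hG, h0, hf⟩
    have hD : ∀ᶠ y in 𝓝 x, MvPolynomial.eval (rep y) G ≠ 0 :=
      (isOpen_coordinateTopology w rep hG).mem_nhds h0
    filter_upwards [hD, hf.eventually_nhds] with y h1 h2
    exact ⟨F, G, m, hF, hG, h1, h2⟩
  ne_zero_eventually := by
    let := coordinateTopology w rep
    rintro f x ⟨F, G, m, hF, hG, h0, hf⟩ hx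
    have hD : ∀ᶠ y in 𝓝 x, MvPolynomial.eval (rep y) G ≠ 0 :=
      (isOpen_coordinateTopology w rep hG).mem_nhds h0
    have hF0 : MvPolynomial.eval (rep x) F ≠ 0 := by
      intro h
      rw [hf.self_of_nhds, h, zero_div] at hx
      exact hx rfl
    have hE : ∀ᶠ y in 𝓝 x, MvPolynomial.eval (rep y) F ≠ 0 :=
      (isOpen_coordinateTopology w rep hF).mem_nhds hF0
    filter_upwards [hD, hE, hf] with y h1 h2 h3
    rw [h3]
    exact div_ne_zero h2 h1

/-- The projective space with homogeneous coordinates indexed by `σ`, with its Zariski topology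
and its regular functions. -/
noncomputable def projectiveSpace (σ : Type) : SpaceWithFunctions :=
  ofCoordinates (X := Projectivization ℂ (σ → ℂ)) (fun _ : σ => (1 : ℕ)) (fun p => p.rep)

/-- The product of two projective spaces, with its Zariski topology and its regular functions, by
means of bihomogeneous polynomials. -/
noncomputable def biprojectiveSpace (σ τ : Type) : SpaceWithFunctions :=
  ofCoordinates (X := Projectivization ℂ (σ → ℂ) × Projectivization ℂ (τ → ℂ))
    (Sum.elim (fun _ : σ => ((1, 0) : ℕ × ℕ)) (fun _ : τ => ((0, 1) : ℕ × ℕ)))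
    (fun p => Sum.elim p.1.rep p.2.rep)

/-- A map that turns homogeneous polynomials in the coordinates of the target into homogeneous
polynomials in those of the source by a renaming of the variables is a morphism. -/
theorem isMorphismAt_of_rename {X Y ι κ M N : Type} [AddCommMonoid M] [AddCommMonoid N]
    {w : ι → M} {v : κ → N} {rep : X → ι → ℂ} {rep' : Y → κ → ℂ} (φ : X → Y) (e : κ → ι)
    (d : N →+ M) (hd : ∀ k, w (e k) = d (v k))
    (hφ : ∀ x k, rep' (φ x) k = rep x (e k)) (x : X) :
    IsMorphismAt (X := ofCoordinates w rep) (Y := ofCoordinates v rep') φ x := by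
  have hev : ∀ (y : X) (F : MvPolynomial κ ℂ),
      MvPolynomial.eval (rep' (φ y)) F = MvPolynomial.eval (rep y) (MvPolynomial.rename e F) := by
    intro y F
    rw [MvPolynomial.eval_rename]
    congr 2
    funext k
    exact hφ y k
  have hren : ∀ (F : MvPolynomial κ ℂ) (n : N), F.IsWeightedHomogeneous v n →
      (MvPolynomial.rename e F).IsWeightedHomogeneous w (d n) := by
    intro F n hF t ht
    obtain ⟨u, rfl, hu⟩ := MvPolynomial.coeff_rename_ne_zero _ _ _ ht
    rw [← hF hu, Finsupp.weight_apply, Finsupp.weight_apply, Finsupp.sum_mapDomain_index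
      (h := fun i c => c • w i) (fun _ => zero_smul ℕ _) (fun _ _ _ => add_smul _ _ _),
      Finsupp.sum, Finsupp.sum, map_sum]
    refine Finset.sum_congr rfl fun k _ => ?_
    rw [hd, map_nsmul]
  have hcont : Continuous (X := (ofCoordinates w rep).Pt) (Y := (ofCoordinates v rep').Pt) φ := by
    refine continuous_generateFrom_iff.2 ?_
    rintro D ⟨F, n, hF, rfl⟩
    have := isOpen_coordinateTopology w rep (hren F n hF)
    simp only [← hev] at this
    exact this
  refine ⟨hcont.continuousAt, ?_⟩
  rintro f ⟨F, G, n, hF, hG, h0, hf⟩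
  refine ⟨_, _, _, hren F n hF, hren G n hG, by rwa [← hev], ?_⟩
  filter_upwards [hcont.continuousAt.eventually hf] with y hy
  rw [hy, hev, hev]

/-- The first projection. -/
noncomputable def biprojectiveSpace.fst (σ τ : Type) :
    Hom (biprojectiveSpace σ τ) (projectiveSpace σ) where
  toFun p := p.1
  isMorphismAt := isMorphismAt_of_rename Prod.fst Sum.inl (AddMonoidHom.inl ℕ ℕ)
    (fun _ => rfl) (fun _ _ => rfl)

/-- The second projection. -/
noncomputable def biprojectiveSpace.snd (σ τ : Type) :
    Hom (biprojectiveSpace σ τ) (projectiveSpace τ) where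
  toFun p := p.2
  isMorphismAt := isMorphismAt_of_rename Prod.snd Sum.inr (AddMonoidHom.inr ℕ ℕ)
    (fun _ => rfl) (fun _ _ => rfl)

/-- The composition of morphisms. -/
def Hom.comp {X Y Z : SpaceWithFunctions} (ψ : Hom Y Z) (φ : Hom X Y) : Hom X Z where
  toFun x := ψ.toFun (φ.toFun x)
  isMorphismAt x := ⟨ContinuousAt.comp (ψ.isMorphismAt _).1 (φ.isMorphismAt x).1,
    fun f hf => (φ.isMorphismAt x).2 _ ((ψ.isMorphismAt _).2 f hf)⟩

/-- A morphism with values in a subset, as a morphism to the subset. -/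
def Hom.codRestrict {X Y : SpaceWithFunctions} (φ : Hom X Y) (Z : Set Y.Pt)
    (hZ : ∀ x, φ.toFun x ∈ Z) : Hom X (Y.restrict Z) where
  toFun x := ⟨φ.toFun x, hZ x⟩
  isMorphismAt x := by
    have hc : ContinuousAt (Y := Z) (fun y => ⟨φ.toFun y, hZ y⟩) x :=
      Topology.IsInducing.subtypeVal.continuousAt_iff.2 (φ.isMorphismAt x).1
    refine ⟨hc, ?_⟩
    rintro f ⟨g, hg, hf⟩
    refine X.regAt_congr ?_ ((φ.isMorphismAt x).2 g hg)
    filter_upwards [hc.eventually hf] with y hy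
    exact hy.symm

/-- The line bundle `𝒪(1)` on a projective space: the cover by the sets `x_i ≠ 0`, and the
transition functions `x_j / x_i`. -/
noncomputable def hyperplaneBundle (σ : Type) : LineBundle (projectiveSpace σ) where
  ι := σ
  V i := {p : Projectivization ℂ (σ → ℂ) | p.rep i ≠ 0}
  isOpen i := by
    have h := isOpen_coordinateTopology (X := Projectivization ℂ (σ → ℂ)) (fun _ : σ => (1 : ℕ))
      (fun p => p.rep) (MvPolynomial.isWeightedHomogeneous_X ℂ (fun _ : σ => (1 : ℕ)) i)
    simp only [MvPolynomial.eval_X] at h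
    exact h
  cover p := Function.ne_iff.1 (Projectivization.rep_nonzero p)
  g i j (p : Projectivization ℂ (σ → ℂ)) := p.rep j / p.rep i
  regAt i j p hp := ⟨MvPolynomial.X j, MvPolynomial.X i, 1,
    MvPolynomial.isWeightedHomogeneous_X ℂ _ j, MvPolynomial.isWeightedHomogeneous_X ℂ _ i,
    by rw [MvPolynomial.eval_X]; exact hp.1, Filter.Eventually.of_forall fun y => by simp⟩
  ne_zero i j p hp := div_ne_zero hp.2 hp.1
  cocycle i j k p hp := by
    have h1 : Projectivization.rep p j ≠ 0 := hp.1.2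
    have h2 : Projectivization.rep p i ≠ 0 := hp.1.1
    field_simp

end SpaceWithFunctions

/-! ## The symmetric determinantal hypersurface and its resolution -/

namespace SymmetricDeterminantal

open SpaceWithFunctions

/-- The symmetric `5 × 5` matrix with given entries; `ℂ ^ 15` is identified with the space of
symmetric matrices in this way. -/
def symMatrix (a : Sym2 (Fin 5) → ℂ) : Matrix (Fin 5) (Fin 5) ℂ :=
  Matrix.of fun i j => a s(i, j)

/-- The projective space `ℙ⁴`. -/
noncomputable def P4 : SpaceWithFunctions := projectiveSpace (Fin 5)

/-- The projective space `ℙ¹⁴` of symmetric `5 × 5` matrices. -/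
noncomputable def P14 : SpaceWithFunctions := projectiveSpace (Sym2 (Fin 5))

/-- The determinantal hypersurface, as a subset of `ℙ¹⁴`. -/
noncomputable def detLocus : Set P14.Pt :=
  {a : Projectivization ℂ (Sym2 (Fin 5) → ℂ) | (symMatrix a.rep).det = 0}

/-- The symmetric determinantal hypersurface `𝓗 ⊂ ℙ¹⁴`. -/
noncomputable def H : SpaceWithFunctions := P14.restrict detLocus

/-- The incidence correspondence, as a subset of `ℙ⁴ × ℙ¹⁴`. -/
noncomputable def incidence : Set (biprojectiveSpace (Fin 5) (Sym2 (Fin 5))).Pt :=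
  {p : Projectivization ℂ (Fin 5 → ℂ) × Projectivization ℂ (Sym2 (Fin 5) → ℂ) |
    (symMatrix p.2.rep).det = 0 ∧ (symMatrix p.2.rep).mulVec p.1.rep = 0}

/-- The variety `𝓤 = {(x, A) ∈ ℙ⁴ × 𝓗 | A x = 0}`. -/
noncomputable def U : SpaceWithFunctions :=
  (biprojectiveSpace (Fin 5) (Sym2 (Fin 5))).restrict incidence

/-- The first projection `π₁ : 𝓤 → ℙ⁴`. -/
noncomputable def π₁ : Hom U P4 :=
  (biprojectiveSpace.fst _ _).comp (SpaceWithFunctions.incl _ _)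

/-- The second projection `π₂ : 𝓤 → 𝓗`. -/
noncomputable def π₂ : Hom U H :=
  ((biprojectiveSpace.snd _ _).comp (SpaceWithFunctions.incl _ _)).codRestrict detLocus
    (fun x => x.2.1)

/-- The class `𝓛 = π₁^* 𝒪(1)`. -/
noncomputable def classL : Pic U := ((hyperplaneBundle (Fin 5)).pullback π₁).toPic

/-- The line bundle `𝒪_𝓗(1)`, the restriction of `𝒪(1)` to `𝓗`. -/
noncomputable def hyperplaneBundleH : LineBundle H :=
  (hyperplaneBundle (Sym2 (Fin 5))).pullback (SpaceWithFunctions.incl P14 detLocus)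

/-- The class `𝓜 = π₂^* 𝒪_𝓗(1)`. -/
noncomputable def classM : Pic U := (hyperplaneBundleH.pullback π₂).toPic

/-- The exceptional locus `𝓔` of `π₂`. -/
noncomputable def E : Set U.Pt := exceptionalLocus π₂

end SymmetricDeterminantal

/-! ## Divisibility by the generic symmetric determinant of size four -/

namespace MvPolynomial

variable {σ K : Type*} [Field K]

/-! On the chart `x i ≠ 0`, normalised by `x i = 1`, the equation `A x = 0` determines the row and
column `i` of `A` from `x` and the complementary symmetric `4 × 4` block, which is arbitrary apart
from being nonzero. So functions on the chart pull back to polynomials in free variables.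

The locus `E` is cut out there by the determinant of this block, the cofactor `adj A i i`
(`mem_E_iff`). If the cofactor is nonzero, the kernel is spanned by a column of the adjugate, which
gives a local inverse of `π₂`. If it vanishes, there is a second kernel vector `w`, and the fibre of
`π₂` contains the line through `x` and `w`.

This determinant generates the full ideal of `E`, not only up to radical, because every polynomial
vanishing on singular symmetric matrices is a multiple of the generic symmetric determinant
(`det_genericSymm_dvd`). That determinant is linear in a corner variable, with the complementary
minor as coefficient. Pseudo-division leaves a remainder free of the corner variable, which must be
zero; coprimality of determinant and minor then removes the powers of the minor. Transported through
the parametrisation this gives `generatesIdealAt_minor`.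

For the class, the adjugate of a singular symmetric matrix killed by `x` is a multiple of `x xᵀ`,
with entries of degree 4 in `A`. Hence the quotients `adj A i j / (x i * x j)` agree for all `i`,
`j` and define a section of `𝓜 ^ 4 ⊗ 𝓛 ^ (-2)`. Locally it is a unit times the minor, so it
generates the ideal of `E`, and `IsReducedDivisor.nonempty_iso` identifies the bundle with `𝒪(E)`.
-/

theorem vars_subset_of_dvd {p q : MvPolynomial σ K} (hq : q ≠ 0) (h : p ∣ q) :
    p.vars ⊆ q.vars := by
  classical
  obtain ⟨r, rfl⟩ := h
  obtain ⟨hp, hr⟩ := mul_ne_zero_iff.1 hq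
  intro n hn
  rw [vars_def, Multiset.mem_toFinset] at hn ⊢
  rw [degrees_mul_eq hp hr]
  exact Multiset.mem_add.2 (Or.inl hn)

theorem aeval_eq_self_of_supported {p : MvPolynomial σ K} {s : Set σ} (hp : p ∈ supported K s)
    {g : σ → MvPolynomial σ K} (hg : ∀ n ∈ s, g n = X n) : aeval g p = p := by
  have h : (aeval g : MvPolynomial σ K →ₐ[K] _) p = aeval X p :=
    hom_congr_vars (f₁ := (aeval g : MvPolynomial σ K →ₐ[K] MvPolynomial σ K).toRingHom)
      (f₂ := (aeval X : MvPolynomial σ K →ₐ[K] MvPolynomial σ K).toRingHom)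
      (by ext; simp) (fun n hn _ => by simp [hg n (mem_supported.1 hp hn)]) rfl
  rw [h, aeval_X_left_apply]

theorem mem_supported_of_dvd {p q : MvPolynomial σ K} {s : Set σ} (hq : q ≠ 0) (h : p ∣ q)
    (hs : q ∈ supported K s) : p ∈ supported K s :=
  mem_supported.2 ((Finset.coe_subset.2 (vars_subset_of_dvd hq h)).trans (mem_supported.1 hs))

/-- If `p` does not involve the variables that `g` changes, then `p` divides the substitution of
`g` in every multiple of `p`. -/
theorem dvd_aeval_of_supported {p q : MvPolynomial σ K} {s : Set σ} (hp : p ∈ supported K s)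
    (h : p ∣ q) {g : σ → MvPolynomial σ K} (hg : ∀ n ∈ s, g n = X n) : p ∣ aeval g q := by
  have := map_dvd (aeval g : MvPolynomial σ K →ₐ[K] _) h
  rwa [aeval_eq_self_of_supported hp hg] at this

variable (K) in
/-- The symmetric matrix with entries the variables `v s(i, j)`. -/
noncomputable def genericSymm {n : ℕ} (v : Sym2 (Fin n) → σ) :
    Matrix (Fin n) (Fin n) (MvPolynomial σ K) :=
  Matrix.of fun i j => X (v s(i, j))

theorem det_mem_supported {n : ℕ} {M : Matrix (Fin n) (Fin n) (MvPolynomial σ K)} {s : Set σ}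
    (h : ∀ i j, M i j ∈ supported K s) : M.det ∈ supported K s := by
  rw [Matrix.det_apply]
  refine sum_mem fun τ _ => ?_
  rw [Units.smul_def, zsmul_eq_mul]
  exact mul_mem (intCast_mem _ _) (prod_mem fun i _ => h _ _)

theorem map_genericSymm {n : ℕ} {R : Type*} [CommRing R] [Algebra K R] (v : Sym2 (Fin n) → σ)
    (g : σ → R) :
    (aeval g : MvPolynomial σ K →ₐ[K] R).mapMatrix (genericSymm K v) =
      Matrix.of fun i j => g (v s(i, j)) := by
  ext i j
  simp [genericSymm]

theorem aeval_det_genericSymm {n : ℕ} {R : Type*} [CommRing R] [Algebra K R]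
    (v : Sym2 (Fin n) → σ) (g : σ → R) :
    aeval g (genericSymm K v).det = (Matrix.of fun i j => g (v s(i, j))).det := by
  rw [AlgHom.map_det, map_genericSymm]

theorem eval_det_genericSymm {n : ℕ} (v : Sym2 (Fin n) → σ) (g : σ → K) :
    eval g (genericSymm K v).det = (Matrix.of fun i j => g (v s(i, j))).det :=
  aeval_det_genericSymm v g

theorem det_genericSymm_ne_zero {n : ℕ} {v : Sym2 (Fin n) → σ} (hv : Function.Injective v) :
    (genericSymm K v).det ≠ 0 := by
  classical
  intro h
  -- Specialise to the identity matrix; injectivity of `v` keeps diagonal and off-diagonal variables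
  -- apart.
  have h1 := congrArg (eval fun k => if ∃ i, k = v s(i, i) then (1 : K) else 0) h
  rw [eval_det_genericSymm, map_zero] at h1
  have h2 : (Matrix.of fun i j : Fin n =>
      if ∃ a, v s(i, j) = v s(a, a) then (1 : K) else 0) = 1 := by
    ext i j
    rw [Matrix.of_apply, Matrix.one_apply]
    refine if_congr ⟨?_, ?_⟩ rfl rfl
    · rintro ⟨a, ha⟩
      have := hv ha
      simp only [Sym2.eq_iff] at this
      aesop
    · rintro rfl
      exact ⟨i, rfl⟩
  rw [h2, Matrix.det_one] at h1
  exact one_ne_zero h1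

/-- The cofactors of the first row do not see that row, so clearing the corner entry changes only
one term of the expansion. This exhibits the determinant as linear in its corner entry. -/
theorem det_eq_mul_add {R : Type*} [CommRing R] {n : ℕ} (M : Matrix (Fin (n + 1)) (Fin (n + 1)) R) :
    M.det = M 0 0 * (M.submatrix Fin.succ Fin.succ).det +
      (Matrix.of fun i j => if i = 0 ∧ j = 0 then 0 else M i j).det := by
  rw [Matrix.det_succ_row_zero M, Matrix.det_succ_row_zero (Matrix.of _), Fin.sum_univ_succ,
    Fin.sum_univ_succ]
  have h : ∀ j : Fin (n + 1), (Matrix.of fun i j => if i = 0 ∧ j = 0 then 0 else M i j).submatrix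
      Fin.succ j.succAbove = M.submatrix Fin.succ j.succAbove := by
    intro j
    ext a b
    simp [Fin.succ_ne_zero]
  simp [h, Fin.succ_ne_zero]

/-- The lower right minor of the generic symmetric matrix of size four. -/
noncomputable abbrev genericMinor (K : Type*) [Field K] (v : Sym2 (Fin 4) → σ) :
    MvPolynomial σ K :=
  (genericSymm K (v ∘ Sym2.map (Fin.succ : Fin 3 → Fin 4))).det

/-- A common divisor involves only the variables of the minor, so specialising the other variables
of the determinant preserves divisibility. Each specialisation confines the divisor to fewer
variables, until it divides 1. -/
theorem isRelPrime_det_genericSymm {v : Sym2 (Fin 4) → σ} (hv : Function.Injective v) :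
    IsRelPrime (genericSymm K v).det (genericMinor K v) := by
  classical
  have hvs : Function.Injective (v ∘ Sym2.map (Fin.succ : Fin 3 → Fin 4)) :=
    hv.comp (Sym2.map.injective (Fin.succ_injective 3))
  intro p hD hm
  have hp : p ∈ supported K (Set.range (v ∘ Sym2.map (Fin.succ : Fin 3 → Fin 4))) :=
    mem_supported_of_dvd (det_genericSymm_ne_zero hvs) hm
      (det_mem_supported fun i j => X_mem_supported.2 ⟨s(i, j), rfl⟩)
  -- The first row becomes `(0, 1, 0, 0)`, which reduces the determinant to minus the minor on the
  -- indices 2 and 3.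
  let g₁ : σ → MvPolynomial σ K := fun n => if n = v s(0, 1) then 1 else
    if n = v s(0, 0) ∨ n = v s(0, 2) ∨ n = v s(0, 3) then 0 else X n
  have hg₁ : ∀ n ∈ Set.range (v ∘ Sym2.map (Fin.succ : Fin 3 → Fin 4)), g₁ n = X n := by
    rintro _ ⟨e, rfl⟩
    induction e with | _ a b
    fin_cases a <;> fin_cases b <;> simp [g₁, hv.eq_iff]
  have h₁ := dvd_aeval_of_supported hp hD hg₁
  have e₁ : aeval g₁ (genericSymm K v).det =
      -(X (v s(2, 2)) * X (v s(3, 3)) - X (v s(2, 3)) ^ 2) := by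
    rw [aeval_det_genericSymm]
    have hM : (Matrix.of fun i j => g₁ (v s(i, j))) =
        !![0, 1, 0, 0; 1, X (v s(1, 1)), X (v s(1, 2)), X (v s(1, 3));
          0, X (v s(1, 2)), X (v s(2, 2)), X (v s(2, 3));
          0, X (v s(1, 3)), X (v s(2, 3)), X (v s(3, 3))] := by
      ext i j : 2
      fin_cases i <;> fin_cases j <;> simp [g₁, hv.eq_iff] <;> rw [Sym2.eq_swap]
    rw [hM]
    simp [Matrix.det_succ_row_zero, Fin.sum_univ_succ, Fin.succAbove]
    ring
  have hne : (X (v s(2, 2)) * X (v s(3, 3)) - X (v s(2, 3)) ^ 2 : MvPolynomial σ K) ≠ 0 := by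
    intro h
    have := congrArg (eval fun n => if n = v s(2, 3) then (0 : K) else 1) h
    simp [hv.eq_iff] at this
  rw [e₁, dvd_neg] at h₁
  have hp' : p ∈ supported K {v s(2, 2), v s(3, 3), v s(2, 3)} :=
    mem_supported_of_dvd hne h₁ (sub_mem (mul_mem (X_mem_supported.2 (by simp))
      (X_mem_supported.2 (by simp))) (pow_mem (X_mem_supported.2 (by simp)) 2))
  -- The matrix becomes the block matrix `[0, 1; 1, B]` with `B` the surviving `2 × 2` block, of
  -- determinant 1.
  let g₂ : σ → MvPolynomial σ K := fun n => if n = v s(0, 2) ∨ n = v s(1, 3) then 1 else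
    if n = v s(2, 2) ∨ n = v s(3, 3) ∨ n = v s(2, 3) then X n else 0
  have hg₂ : ∀ n ∈ ({v s(2, 2), v s(3, 3), v s(2, 3)} : Set σ), g₂ n = X n := by
    rintro _ (rfl | rfl | rfl) <;> simp [g₂, hv.eq_iff]
  have h₂ := dvd_aeval_of_supported hp' hD hg₂
  have e₂ : aeval g₂ (genericSymm K v).det = 1 := by
    rw [aeval_det_genericSymm]
    have hM : (Matrix.of fun i j => g₂ (v s(i, j))) =
        !![0, 0, 1, 0; 0, 0, 0, 1; 1, 0, X (v s(2, 2)), X (v s(2, 3));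
          0, 1, X (v s(2, 3)), X (v s(3, 3))] := by
      ext i j : 2
      fin_cases i <;> fin_cases j <;> simp [g₂, hv.eq_iff] <;> rw [Sym2.eq_swap]
    rw [hM]
    simp [Matrix.det_succ_row_zero, Fin.sum_univ_succ, Fin.succAbove]
  rw [e₂] at h₂
  exact isUnit_of_dvd_one h₂

/-- Pseudo-division by a polynomial that is linear in the variable `b` with leading
coefficient `m`. -/
theorem exists_pow_mul_sub_dvd [DecidableEq σ] {b : σ} {D m c : MvPolynomial σ K}
    (hD : D = X b * m + c) (hm : m ∈ supported K {b}ᶜ) (hc : c ∈ supported K {b}ᶜ)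
    (P : MvPolynomial σ K) : ∃ k, ∃ R ∈ supported K {b}ᶜ, D ∣ m ^ k * P - R := by
  induction P using MvPolynomial.induction_on with
  | C a => exact ⟨0, C a, Subalgebra.algebraMap_mem _ a, by simp⟩
  | add P Q hP hQ =>
    obtain ⟨k, R, hR, u, hu⟩ := hP
    obtain ⟨l, S, hS, w, hw⟩ := hQ
    refine ⟨k + l, m ^ l * R + m ^ k * S,
      add_mem (mul_mem (pow_mem hm _) hR) (mul_mem (pow_mem hm _) hS), m ^ l * u + m ^ k * w, ?_⟩
    linear_combination m ^ l * hu + m ^ k * hw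
  | mul_X P n hP =>
    obtain ⟨k, R, hR, u, hu⟩ := hP
    by_cases hn : n = b
    · subst hn
      -- Modulo `D` the product of the variable `b` and `m` is `-c`, so one more factor `m`
      -- eliminates the new occurrence of the variable.
      refine ⟨k + 1, -(c * R), neg_mem (mul_mem hc hR), m * X n * u + R, ?_⟩
      linear_combination m * X n * hu - R * hD
    · refine ⟨k, R * X n, mul_mem hR (X_mem_supported.2 hn), u * X n, ?_⟩
      linear_combination X n * hu

theorem eval_update_of_supported [DecidableEq σ] {b : σ} {R : MvPolynomial σ K}
    (hR : R ∈ supported K {b}ᶜ) (a : σ → K) (t : K) :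
    eval (Function.update a b t) R = eval a R :=
  hom_congr_vars (by ext; simp) (fun n hn _ => by
    have : n ≠ b := mem_supported.1 hR hn
    simp [this]) rfl

/-- A polynomial that vanishes on the singular symmetric matrices is divisible by the generic
symmetric determinant. -/
theorem det_genericSymm_dvd [Infinite K] {v : Sym2 (Fin 4) → σ} (hv : Function.Injective v)
    {P : MvPolynomial σ K} (hP : ∀ a : σ → K, eval a (genericSymm K v).det = 0 →
      eval a (genericMinor K v) ≠ 0 → eval a P = 0) :
    (genericSymm K v).det ∣ P := by
  classical
  have hvs : Function.Injective (v ∘ Sym2.map (Fin.succ : Fin 3 → Fin 4)) :=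
    hv.comp (Sym2.map.injective (Fin.succ_injective 3))
  have hD := det_eq_mul_add (genericSymm K v)
  set D := (genericSymm K v).det
  have hm : genericMinor K v ∈ supported K {v s(0, 0)}ᶜ := by
    refine det_mem_supported fun i j => X_mem_supported.2 fun h => ?_
    have := hv h
    simp [Fin.succ_ne_zero] at this
  have hc : (Matrix.of fun i j => if i = 0 ∧ j = 0 then 0 else genericSymm K v i j).det ∈
      supported K {v s(0, 0)}ᶜ := by
    refine det_mem_supported fun i j => ?_
    rw [Matrix.of_apply]
    split_ifs with h
    · exact zero_mem _
    · refine X_mem_supported.2 fun h' => h ?_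
      have := hv h'
      simpa [Sym2.eq_iff] using this
  have hm' : ((genericSymm K v).submatrix Fin.succ Fin.succ).det = genericMinor K v := rfl
  rw [hm'] at hD
  set m := genericMinor K v
  set c := (Matrix.of fun i j => if i = 0 ∧ j = 0 then 0 else genericSymm K v i j).det
  have hD' : D = X (v s(0, 0)) * m + c := hD
  obtain ⟨k, R, hR, hk⟩ := exists_pow_mul_sub_dvd hD' hm hc P
  -- Wherever `m ≠ 0`, the corner variable can be set to `-c / m` to reach `D = 0`; neither `R` nor
  -- `m` notices the change. So `R` vanishes wherever `m` does not.
  have hRm : R * m = 0 := by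
    refine MvPolynomial.funext fun a => ?_
    rw [map_mul, map_zero]
    by_cases h : eval a m = 0
    · rw [h, mul_zero]
    have h1 := eval_update_of_supported hR a (-eval a c / eval a m)
    have h2 := eval_update_of_supported hm a (-eval a c / eval a m)
    have h3 := eval_update_of_supported hc a (-eval a c / eval a m)
    set a' := Function.update a (v s(0, 0)) (-eval a c / eval a m)
    have h4 : eval a' D = 0 := by
      rw [hD', map_add, map_mul, eval_X, h2, h3]
      simp only [a', Function.update_self]
      field_simp
      ring
    have h5 := hP a' h4 (h2 ▸ h)
    obtain ⟨u, hu⟩ := hk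
    have h6 := congrArg (eval a') hu
    rw [map_sub, map_mul, map_mul, h4, h5, h1] at h6
    have : eval a R = 0 := by linear_combination -h6
    rw [this, zero_mul]
  have hR0 : R = 0 := (mul_eq_zero.1 hRm).resolve_right (det_genericSymm_ne_zero hvs)
  rw [hR0, sub_zero] at hk
  exact (isRelPrime_det_genericSymm hv).pow_right.dvd_of_dvd_mul_left hk

end MvPolynomial

/-! ## Regular functions, divisors and coordinates -/

namespace SpaceWithFunctions

open MvPolynomial

theorem regAt_eval {X : SpaceWithFunctions} {x : X.Pt} {σ : Type*} {u : σ → X.Pt → ℂ}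
    (hu : ∀ s, X.RegAt (u s) x) (P : MvPolynomial σ ℂ) :
    X.RegAt (fun y => eval (fun s => u s y) P) x := by
  induction P using MvPolynomial.induction_on with
  | C a => simpa using X.regAt_const a x
  | add P Q hP hQ => simpa using X.regAt_add hP hQ
  | mul_X P n hP => simpa using X.regAt_mul hP (hu n)

theorem regAt_div {X : SpaceWithFunctions} {x : X.Pt} {f g : X.Pt → ℂ} (hf : X.RegAt f x)
    (hg : X.RegAt g x) (h0 : g x ≠ 0) : X.RegAt (fun y => f y / g y) x := by
  simpa only [div_eq_mul_inv] using X.regAt_mul hf (X.regAt_inv hg h0)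

/-- The ideal of a divisor is also generated by the product of a generator and a unit. -/
theorem GeneratesIdealAt.of_eventually_eq_mul {X : SpaceWithFunctions} {Z : Set X.Pt}
    {f g u : X.Pt → ℂ} {x : X.Pt} (h : GeneratesIdealAt Z f x) (hu : X.RegAt u x) (h0 : u x ≠ 0)
    (hg : ∀ᶠ y in 𝓝 x, g y = u y * f y) : GeneratesIdealAt Z g x := by
  have hne := X.ne_zero_eventually hu h0
  refine ⟨X.regAt_congr (hg.mono fun y hy => hy.symm) (X.regAt_mul hu h.1), fun k hk => ?_,
    fun q hq hz => ?_⟩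
  · rw [h.2.1 k hk]
    constructor
    · rintro ⟨q, hq, e⟩
      refine ⟨_, X.regAt_mul hq (X.regAt_inv hu h0), ?_⟩
      filter_upwards [e, hg, hne] with y h1 h2 h3
      rw [h1, h2]
      field_simp
    · rintro ⟨q, hq, e⟩
      refine ⟨_, X.regAt_mul hq hu, ?_⟩
      filter_upwards [e, hg] with y h1 h2
      rw [h1, h2, mul_assoc]
  · have h1 := h.2.2 (fun y => q y * u y) (X.regAt_mul hq hu) (by
      filter_upwards [hz, hg] with y h1 h2
      rw [← h1, h2, mul_assoc])
    filter_upwards [h1, hne] with y h2 h3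
    exact (mul_eq_zero.1 h2).resolve_right h3

/-- A line bundle with a section that locally generates the ideal of a reduced divisor is the
line bundle of that divisor. -/
theorem IsReducedDivisor.nonempty_iso {X : SpaceWithFunctions} {Z : Set X.Pt}
    (hZ : IsReducedDivisor Z) (L : LineBundle X) (s : L.ι → X.Pt → ℂ)
    (hs : ∀ j, ∀ x ∈ L.V j, GeneratesIdealAt Z (s j) x)
    (hg : ∀ i j, ∀ x ∈ L.V i ∩ L.V j, s i x = L.g i j x * s j x) :
    Nonempty (LineBundle.Iso hZ.lineBundle L) := by
  have hf : ∀ i, ∀ x ∈ hZ.lineBundle.V i, GeneratesIdealAt Z ((hZ i).choose_spec.choose) x :=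
    fun i x hx => (hZ i).choose_spec.choose_spec.2.2 x hx
  have hsf : ∀ i j, ∀ x ∈ hZ.lineBundle.V i ∩ L.V j,
      quotientAt X (s j) (hZ i).choose_spec.choose x *
        quotientAt X (hZ i).choose_spec.choose (s j) x = 1 := fun i j x hx => by
    rw [quotientAt_mul ((hZ.lineBundle.isOpen i).inter (L.isOpen j)) hx
      (fun y hy => hs j y hy.2) (fun y hy => hf i y hy.1) (fun y hy => hs j y hy.2),
      quotientAt_self (hs j x hx.2)]
  -- The isomorphism is the ratio of the two local equations of `Z`; compatibility is
  -- multiplicativity of such ratios.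
  refine ⟨{ φ := fun i j => quotientAt X (s j) (hZ i).choose_spec.choose
            regAt := fun i j x hx =>
              (quotientAt_spec ((hZ.lineBundle.isOpen i).inter (L.isOpen j)) hx
                (fun y hy => hs j y hy.2) (fun y hy => hf i y hy.1)).1
            ne_zero := fun i j x hx => left_ne_zero_of_mul_eq_one (hsf i j x hx)
            compat := ?_ }⟩
  intro i k j l x hx
  have hW : IsOpen (hZ.lineBundle.V i ∩ hZ.lineBundle.V k ∩ (L.V j ∩ L.V l)) :=
    ((hZ.lineBundle.isOpen i).inter (hZ.lineBundle.isOpen k)).inter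
      ((L.isOpen j).inter (L.isOpen l))
  have h1 : quotientAt X (s j) (hZ i).choose_spec.choose x *
      quotientAt X (hZ i).choose_spec.choose (hZ k).choose_spec.choose x =
        quotientAt X (s j) (hZ k).choose_spec.choose x :=
    quotientAt_mul hW hx (fun y hy => hs j y hy.2.1) (fun y hy => hf i y hy.1.1)
      (fun y hy => hf k y hy.1.2)
  have h2 : quotientAt X (s j) (s l) x * quotientAt X (s l) (hZ k).choose_spec.choose x =
      quotientAt X (s j) (hZ k).choose_spec.choose x :=
    quotientAt_mul hW hx (fun y hy => hs j y hy.2.1) (fun y hy => hs l y hy.2.2)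
      (fun y hy => hf k y hy.1.2)
  have h3 : quotientAt X (s j) (s l) x = L.g j l x := by
    refine quotientAt_eq (hs l x hx.2.2) (L.regAt j l x hx.2) ?_
    filter_upwards [hW.mem_nhds hx] with y hy
    exact hg j l y hy.2
  rw [← h3, h2]
  exact h1

/-- Non-vanishing loci are closed under intersection, since a product of homogeneous polynomials is
homogeneous. Hence one polynomial suffices to describe a small neighbourhood. -/
theorem isTopologicalBasis_coordinateTopology {X ι M : Type} [AddCommMonoid M] (w : ι → M)
    (rep : X → ι → ℂ) :
    TopologicalSpace.IsTopologicalBasis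
      {D : Set (ofCoordinates w rep).Pt | ∃ (F : MvPolynomial ι ℂ) (m : M), F.IsWeightedHomogeneous w m ∧
        D = {x | eval (rep x) F ≠ 0}} := by
  refine ⟨?_, ?_, rfl⟩
  · rintro _ ⟨F, m, hF, rfl⟩ _ ⟨G, n, hG, rfl⟩ x hx
    refine ⟨_, ⟨F * G, m + n, hF.mul hG, rfl⟩, ?_, fun y hy => ?_⟩
    · change eval (rep x) (F * G) ≠ 0
      rw [map_mul]
      exact mul_ne_zero hx.1 hx.2
    · change eval (rep y) (F * G) ≠ 0 at hy
      rw [map_mul] at hy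
      exact ⟨left_ne_zero_of_mul hy, right_ne_zero_of_mul hy⟩
  · refine Set.eq_univ_of_forall fun x => ⟨_, ⟨1, 0, isWeightedHomogeneous_one ℂ w, rfl⟩, ?_⟩
    change eval (rep x) 1 ≠ 0
    rw [map_one]
    exact one_ne_zero

/-- Neighbourhoods in a subset of a space with coordinates. -/
theorem eventually_restrict_iff {X ι M : Type} [AddCommMonoid M] {w : ι → M} {rep : X → ι → ℂ}
    {Z : Set (ofCoordinates w rep).Pt} {p : ((ofCoordinates w rep).restrict Z).Pt}
    {P : ((ofCoordinates w rep).restrict Z).Pt → Prop} :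
    (∀ᶠ y in 𝓝 p, P y) ↔ ∃ (F : MvPolynomial ι ℂ) (m : M), F.IsWeightedHomogeneous w m ∧
      eval (rep p.1) F ≠ 0 ∧
        ∀ y : ((ofCoordinates w rep).restrict Z).Pt, eval (rep y.1) F ≠ 0 → P y := by
  have hb := (isTopologicalBasis_coordinateTopology w rep).nhds_hasBasis (a := p.1)
  have hc := hb.comap (Subtype.val : Z → (ofCoordinates w rep).Pt)
  rw [← nhds_subtype Z p] at hc
  refine hc.eventually_iff.trans ?_
  constructor
  · rintro ⟨_, ⟨⟨F, m, hF, rfl⟩, hp⟩, h⟩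
    exact ⟨F, m, hF, hp, fun y hy => h hy⟩
  · rintro ⟨F, m, hF, hp, h⟩
    exact ⟨_, ⟨⟨F, m, hF, rfl⟩, hp⟩, fun y hy => h y hy⟩

/-- Regular functions on a subset of a space with coordinates are locally quotients of
homogeneous polynomials. -/
theorem RegAt.exists_eq_div {X ι M : Type} [AddCommMonoid M] {w : ι → M} {rep : X → ι → ℂ}
    {Z : Set (ofCoordinates w rep).Pt} {p : ((ofCoordinates w rep).restrict Z).Pt}
    {f : ((ofCoordinates w rep).restrict Z).Pt → ℂ}
    (h : ((ofCoordinates w rep).restrict Z).RegAt f p) :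
    ∃ (F G : MvPolynomial ι ℂ) (m : M), F.IsWeightedHomogeneous w m ∧
      G.IsWeightedHomogeneous w m ∧ eval (rep p.1) G ≠ 0 ∧
        ∀ᶠ y in 𝓝 p, f y = eval (rep y.1) F / eval (rep y.1) G := by
  obtain ⟨g, ⟨F, G, m, hF, hG, h0, e⟩, h1⟩ := h
  refine ⟨F, G, m, hF, hG, h0, ?_⟩
  have e' : ∀ᶠ y in 𝓝 p, g y.1 = eval (rep y.1) F / eval (rep y.1) G :=
    (incl (ofCoordinates w rep) Z).isMorphismAt p |>.1.eventually e
  filter_upwards [h1, e'] with y h2 h3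
  rw [h2, h3]

theorem regAt_restrict_div {X ι M : Type} [AddCommMonoid M] {w : ι → M} {rep : X → ι → ℂ}
    {Z : Set (ofCoordinates w rep).Pt} {p : ((ofCoordinates w rep).restrict Z).Pt} {F G : MvPolynomial ι ℂ} {m : M}
    (hF : F.IsWeightedHomogeneous w m) (hG : G.IsWeightedHomogeneous w m)
    (h0 : eval (rep p.1) G ≠ 0) :
    ((ofCoordinates w rep).restrict Z).RegAt
      (fun y => eval (rep y.1) F / eval (rep y.1) G) p :=
  ((incl (ofCoordinates w rep) Z).isMorphismAt p).2 _
    ⟨F, G, m, hF, hG, h0, Filter.Eventually.of_forall fun _ => rfl⟩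

/-- Scaling the coordinates of a bihomogeneous polynomial. -/
theorem eval_smul_of_bihomogeneous {σ τ : Type} {F : MvPolynomial (σ ⊕ τ) ℂ} {m : ℕ × ℕ}
    (hF : F.IsWeightedHomogeneous
      (Sum.elim (fun _ : σ => ((1, 0) : ℕ × ℕ)) (fun _ : τ => ((0, 1) : ℕ × ℕ))) m)
    (c d : ℂ) (x : σ → ℂ) (a : τ → ℂ) :
    eval (Sum.elim (c • x) (d • a)) F = c ^ m.1 * d ^ m.2 * eval (Sum.elim x a) F := by
  rw [eval_eq, eval_eq, Finset.mul_sum]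
  refine Finset.sum_congr rfl fun t ht => ?_
  have hw := hF (mem_support_iff.1 ht)
  have key : ∏ i ∈ t.support, Sum.elim (c • x) (d • a) i ^ t i =
      c ^ m.1 * d ^ m.2 * ∏ i ∈ t.support, Sum.elim x a i ^ t i := by
    rw [← hw, Finsupp.weight_apply, Finsupp.sum, Prod.fst_sum, Prod.snd_sum,
      ← Finset.prod_pow_eq_pow_sum, ← Finset.prod_pow_eq_pow_sum, ← Finset.prod_mul_distrib,
      ← Finset.prod_mul_distrib]
    refine Finset.prod_congr rfl fun i _ => ?_
    cases i <;> simp [mul_pow]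
  rw [key]
  ring

end SpaceWithFunctions

/-! ## Kernels of symmetric matrices -/

/-- The columns of the adjugate of a singular matrix are proportional to every vector in the
kernel. -/
theorem Matrix.mul_adjugate_eq_of_mulVec_eq_zero {n K : Type*} [Fintype n] [DecidableEq n]
    [Field K] {A : Matrix n n K} {x : n → K} (h : A.mulVec x = 0) (hx : x ≠ 0) (i j k : n) :
    x k * A.adjugate i j = x i * A.adjugate k j := by
  -- The new row `x k • e_i - x i • e_k` also annihilates `x`, so the matrix stays singular;
  -- expanding its determinant linearly in that row gives the relation.
  have h0 : (A.updateRow j (x k • Pi.single i 1 + (-x i) • Pi.single k 1)).det = 0 := by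
    refine Matrix.exists_mulVec_eq_zero_iff.1 ⟨x, hx, ?_⟩
    rw [Matrix.updateRow_mulVec, h]
    ext l
    by_cases hl : l = j
    · subst hl
      simp [add_dotProduct]
      ring
    · simp [hl]
  rw [Matrix.det_updateRow_add, Matrix.det_updateRow_smul, Matrix.det_updateRow_smul,
    ← Matrix.adjugate_apply, ← Matrix.adjugate_apply] at h0
  linear_combination h0

theorem Matrix.adjugate_apply_self_eq_det_submatrix {n : ℕ} {R : Type*} [CommRing R]
    (A : Matrix (Fin (n + 1)) (Fin (n + 1)) R) (i : Fin (n + 1)) :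
    A.adjugate i i = (A.submatrix i.succAbove i.succAbove).det := by
  rw [Matrix.adjugate_fin_succ_eq_det_submatrix, Even.neg_one_pow ⟨_, rfl⟩, one_mul]

/-- A singular symmetric matrix with a kernel vector `x` and a vanishing principal minor at an
index `i` with `x i ≠ 0` has a further kernel vector. -/
theorem Matrix.exists_mulVec_eq_zero_of_adjugate_eq_zero {n : ℕ} {K : Type*} [Field K]
    {A : Matrix (Fin (n + 1)) (Fin (n + 1)) K} (hA : A.IsSymm) {x : Fin (n + 1) → K}
    (h : A.mulVec x = 0) {i : Fin (n + 1)} (hx : x i ≠ 0) (h0 : A.adjugate i i = 0) :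
    ∃ w ≠ 0, w i = 0 ∧ A.mulVec w = 0 := by
  rw [Matrix.adjugate_apply_self_eq_det_submatrix] at h0
  obtain ⟨u, hu, hAu⟩ := Matrix.exists_mulVec_eq_zero_iff.2 h0
  have hb : ∀ b, A.mulVec (i.insertNth 0 u) (i.succAbove b) = 0 := by
    intro b
    have := congrFun hAu b
    simpa [Matrix.mulVec, dotProduct, Fin.sum_univ_succAbove _ i] using this
  refine ⟨i.insertNth 0 u, ?_, by simp, ?_⟩
  · rintro h1
    refine hu (funext fun b => ?_)
    have := congrFun h1 (i.succAbove b)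
    simpa using this
  -- Only the entry `i` of `A w` is left. By symmetry `xᵀ A w = 0`, and this sum reduces to `x i`
  -- times that entry.
  · have h2 : x ⬝ᵥ A.mulVec (i.insertNth 0 u) = 0 := by
      rw [Matrix.dotProduct_mulVec, ← Matrix.mulVec_transpose, hA.eq, h, zero_dotProduct]
    rw [dotProduct, Fin.sum_univ_succAbove _ i] at h2
    simp only [hb, mul_zero, Finset.sum_const_zero, add_zero] at h2
    ext k
    refine Fin.succAboveCases i ?_ hb k
    exact (mul_eq_zero.1 h2).resolve_left hx

namespace SymmetricDeterminantal

open SpaceWithFunctions MvPolynomial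

/-! ## Coordinates on the incidence variety -/

/-- The bidegrees of the coordinates of `ℙ⁴ × ℙ¹⁴`. -/
abbrev biWeight : Fin 5 ⊕ Sym2 (Fin 5) → ℕ × ℕ :=
  Sum.elim (fun _ => (1, 0)) (fun _ => (0, 1))

/-- Homogeneous coordinates of a symmetric matrix in `𝓗`. -/
noncomputable def coordH (q : H.Pt) : Sym2 (Fin 5) → ℂ :=
  Projectivization.rep (K := ℂ) (V := Sym2 (Fin 5) → ℂ) q.1

/-- Homogeneous coordinates of the kernel vector. -/
noncomputable def coordX (p : U.Pt) : Fin 5 → ℂ :=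
  Projectivization.rep (K := ℂ) (V := Fin 5 → ℂ) (π₁.toFun p)

/-- Homogeneous coordinates of the symmetric matrix. -/
noncomputable def coordA (p : U.Pt) : Sym2 (Fin 5) → ℂ := coordH (π₂.toFun p)

/-- Bihomogeneous coordinates. -/
noncomputable abbrev coord (p : U.Pt) : Fin 5 ⊕ Sym2 (Fin 5) → ℂ :=
  Sum.elim (coordX p) (coordA p)

theorem coordH_ne_zero (q : H.Pt) : coordH q ≠ 0 :=
  Projectivization.rep_nonzero (K := ℂ) (V := Sym2 (Fin 5) → ℂ) q.1

theorem coordX_ne_zero (p : U.Pt) : coordX p ≠ 0 :=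
  Projectivization.rep_nonzero (K := ℂ) (V := Fin 5 → ℂ) (π₁.toFun p)

theorem exists_coordX_ne_zero (p : U.Pt) : ∃ i, coordX p i ≠ 0 :=
  Function.ne_iff.1 (coordX_ne_zero p)

theorem exists_coordA_ne_zero (p : U.Pt) : ∃ e, coordA p e ≠ 0 :=
  Function.ne_iff.1 (coordH_ne_zero (π₂.toFun p))

theorem det_coordH (q : H.Pt) : (symMatrix (coordH q)).det = 0 := q.2

theorem mulVec_coord (p : U.Pt) : (symMatrix (coordA p)).mulVec (coordX p) = 0 := p.2.2

theorem isSymm_symMatrix (a : Sym2 (Fin 5) → ℂ) : (symMatrix a).IsSymm := by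
  ext i j
  simp [symMatrix, Sym2.eq_swap]

theorem symMatrix_smul (c : ℂ) (a : Sym2 (Fin 5) → ℂ) : symMatrix (c • a) = c • symMatrix a :=
  rfl

/-- The point of `𝓤` with given homogeneous coordinates. -/
theorem exists_point {x : Fin 5 → ℂ} {a : Sym2 (Fin 5) → ℂ} (hx : x ≠ 0) (ha : a ≠ 0)
    (h : (symMatrix a).mulVec x = 0) :
    ∃ p : U.Pt, (∃ c : ℂ, c ≠ 0 ∧ coordX p = c • x) ∧ (∃ d : ℂ, d ≠ 0 ∧ coordA p = d • a) := by
  obtain ⟨c, hc⟩ := Projectivization.exists_smul_eq_mk_rep ℂ x hx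
  obtain ⟨d, hd⟩ := Projectivization.exists_smul_eq_mk_rep ℂ a ha
  have h' : (symMatrix (Projectivization.mk ℂ a ha).rep).mulVec
      (Projectivization.mk ℂ x hx).rep = 0 := by
    rw [← hc, ← hd, Units.smul_def, Units.smul_def, symMatrix_smul, Matrix.smul_mulVec,
      Matrix.mulVec_smul, h, smul_zero, smul_zero]
  refine ⟨⟨(Projectivization.mk ℂ x hx, Projectivization.mk ℂ a ha),
    Matrix.exists_mulVec_eq_zero_iff.1 ⟨_, Projectivization.rep_nonzero _, h'⟩, h'⟩,
    ⟨c, c.ne_zero, hc.symm⟩, ⟨d, d.ne_zero, hd.symm⟩⟩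

theorem eq_of_rep_eq_smul {σ : Type} {u v : Projectivization ℂ (σ → ℂ)} {c : ℂ}
    (h : u.rep = c • v.rep) : u = v := by
  rw [← u.mk_rep, ← v.mk_rep]
  exact (Projectivization.mk_eq_mk_iff' ℂ _ _ _ _).2 ⟨c, h.symm⟩

theorem point_ext {p q : U.Pt} {c : ℂ} (hx : coordX p = c • coordX q)
    (ha : π₂.toFun p = π₂.toFun q) : p = q :=
  Subtype.ext (Prod.ext (eq_of_rep_eq_smul hx) (congrArg Subtype.val ha))

theorem pointH_ext {p q : H.Pt} {c : ℂ} (h : coordH p = c • coordH q) : p = q :=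
  Subtype.ext (eq_of_rep_eq_smul h)

theorem eventually_iff {p : U.Pt} {P : U.Pt → Prop} :
    (∀ᶠ y in 𝓝 p, P y) ↔ ∃ (F : MvPolynomial (Fin 5 ⊕ Sym2 (Fin 5)) ℂ) (m : ℕ × ℕ),
      F.IsWeightedHomogeneous biWeight m ∧ eval (coord p) F ≠ 0 ∧
        ∀ y : U.Pt, eval (coord y) F ≠ 0 → P y :=
  eventually_restrict_iff

theorem exists_eq_div {p : U.Pt} {f : U.Pt → ℂ} (h : U.RegAt f p) :
    ∃ (F G : MvPolynomial (Fin 5 ⊕ Sym2 (Fin 5)) ℂ) (m : ℕ × ℕ),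
      F.IsWeightedHomogeneous biWeight m ∧ G.IsWeightedHomogeneous biWeight m ∧
        eval (coord p) G ≠ 0 ∧ ∀ᶠ y in 𝓝 p, f y = eval (coord y) F / eval (coord y) G :=
  RegAt.exists_eq_div h

theorem eventually_coordX_ne_zero {p : U.Pt} {i : Fin 5} (h : coordX p i ≠ 0) :
    ∀ᶠ y in 𝓝 p, coordX y i ≠ 0 :=
  eventually_iff.2 ⟨X (Sum.inl i), _, isWeightedHomogeneous_X ℂ _ _, by simpa using h,
    fun y hy => by simpa using hy⟩

theorem eventually_coordA_ne_zero {p : U.Pt} {e : Sym2 (Fin 5)} (h : coordA p e ≠ 0) :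
    ∀ᶠ y in 𝓝 p, coordA y e ≠ 0 :=
  eventually_iff.2 ⟨X (Sum.inr e), _, isWeightedHomogeneous_X ℂ _ _, by simpa using h,
    fun y hy => by simpa using hy⟩

theorem eventually_coordH_ne_zero {q : H.Pt} {e : Sym2 (Fin 5)} (h : coordH q e ≠ 0) :
    ∀ᶠ y in 𝓝 q, coordH y e ≠ 0 :=
  eventually_restrict_iff.2 ⟨X e, _, isWeightedHomogeneous_X ℂ _ _, by rw [eval_X]; exact h,
    fun y hy => by rw [eval_X] at hy; exact hy⟩

/-- The affine coordinates on the chart `x i ≠ 0`, `A e ≠ 0`. -/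
noncomputable def affine (i : Fin 5) (e : Sym2 (Fin 5)) (p : U.Pt) : Fin 5 ⊕ Sym2 (Fin 5) → ℂ :=
  Sum.elim ((coordX p i)⁻¹ • coordX p) ((coordA p e)⁻¹ • coordA p)

theorem eval_affine {F : MvPolynomial (Fin 5 ⊕ Sym2 (Fin 5)) ℂ} {m : ℕ × ℕ}
    (hF : F.IsWeightedHomogeneous biWeight m) (i : Fin 5) (e : Sym2 (Fin 5)) (p : U.Pt) :
    eval (affine i e p) F =
      (coordX p i)⁻¹ ^ m.1 * (coordA p e)⁻¹ ^ m.2 * eval (coord p) F :=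
  eval_smul_of_bihomogeneous hF _ _ _ _

theorem eval_affine_eq_zero_iff {F : MvPolynomial (Fin 5 ⊕ Sym2 (Fin 5)) ℂ} {m : ℕ × ℕ}
    (hF : F.IsWeightedHomogeneous biWeight m) {i : Fin 5} {e : Sym2 (Fin 5)} {p : U.Pt}
    (hi : coordX p i ≠ 0) (he : coordA p e ≠ 0) :
    eval (affine i e p) F = 0 ↔ eval (coord p) F = 0 := by
  rw [eval_affine hF]
  simp [hi, he]

theorem eval_affine_div {F G : MvPolynomial (Fin 5 ⊕ Sym2 (Fin 5)) ℂ} {m : ℕ × ℕ}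
    (hF : F.IsWeightedHomogeneous biWeight m) (hG : G.IsWeightedHomogeneous biWeight m)
    {i : Fin 5} {e : Sym2 (Fin 5)} {p : U.Pt} (hi : coordX p i ≠ 0) (he : coordA p e ≠ 0) :
    eval (affine i e p) F / eval (affine i e p) G = eval (coord p) F / eval (coord p) G := by
  rw [eval_affine hF, eval_affine hG]
  exact mul_div_mul_left _ _ (by simp [hi, he])

theorem regAt_affine {i : Fin 5} {e : Sym2 (Fin 5)} {p : U.Pt} (hi : coordX p i ≠ 0)
    (he : coordA p e ≠ 0) (n : Fin 5 ⊕ Sym2 (Fin 5)) : U.RegAt (fun y => affine i e y n) p := by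
  have key : ∀ k k' : Fin 5 ⊕ Sym2 (Fin 5), biWeight k = biWeight k' → coord p k' ≠ 0 →
      U.RegAt (fun y => coord y k / coord y k') p := by
    intro k k' hk h
    have h1 : (X k : MvPolynomial _ ℂ).IsWeightedHomogeneous biWeight (biWeight k') :=
      hk ▸ isWeightedHomogeneous_X ℂ _ k
    have := regAt_restrict_div (rep := fun p : Projectivization ℂ (Fin 5 → ℂ) ×
      Projectivization ℂ (Sym2 (Fin 5) → ℂ) => Sum.elim p.1.rep p.2.rep) (Z := incidence) (p := p)
      h1 (isWeightedHomogeneous_X ℂ _ k') (by rw [eval_X]; exact h)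
    simp only [eval_X] at this
    exact this
  cases n with
  | inl j =>
    have := key (Sum.inl j) (Sum.inl i) rfl hi
    simpa [affine, div_eq_inv_mul] using this
  | inr e' =>
    have := key (Sum.inr e') (Sum.inr e) rfl he
    simpa [affine, div_eq_inv_mul] using this

/-- A map to `𝓤` is a morphism at a point if its affine coordinates are regular. -/
theorem isMorphismAt_of_affine {Y : SpaceWithFunctions} {φ : Y.Pt → U.Pt} {y : Y.Pt} {i : Fin 5}
    {e : Sym2 (Fin 5)} (hi : ∀ᶠ z in 𝓝 y, coordX (φ z) i ≠ 0)
    (he : ∀ᶠ z in 𝓝 y, coordA (φ z) e ≠ 0)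
    (hr : ∀ n, Y.RegAt (fun z => affine i e (φ z) n) y) : IsMorphismAt φ y := by
  have hF := fun F => regAt_eval hr F
  have hc : ContinuousAt φ y := by
    refine Filter.tendsto_def.2 fun S hS => ?_
    obtain ⟨F, m, hm, h0, h⟩ := eventually_iff.1 hS
    have h1 := Y.ne_zero_eventually (hF F)
      (mt (eval_affine_eq_zero_iff hm hi.self_of_nhds he.self_of_nhds).1 h0)
    filter_upwards [h1, hi, he] with z h2 h3 h4
    exact h _ (mt (eval_affine_eq_zero_iff hm h3 h4).2 h2)
  refine ⟨hc, fun f hf => ?_⟩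
  obtain ⟨F, G, m, hm, hm', h0, h⟩ := exists_eq_div hf
  refine Y.regAt_congr ?_ (regAt_div (hF F) (hF G)
      (mt (eval_affine_eq_zero_iff hm' hi.self_of_nhds he.self_of_nhds).1 h0))
  filter_upwards [hc.eventually h, hi, he] with z h2 h3 h4
  rw [h2, eval_affine_div hm hm' h3 h4]

end SymmetricDeterminantal

namespace SymmetricDeterminantal

open SpaceWithFunctions MvPolynomial

/-! ## The exceptional locus -/

/-- The affine coordinates on `𝓗`. -/
theorem regAt_affineH {q : H.Pt} {e : Sym2 (Fin 5)} (he : coordH q e ≠ 0) (e' : Sym2 (Fin 5)) :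
    H.RegAt (fun y => ((coordH y e)⁻¹ • coordH y) e') q := by
  have := regAt_restrict_div (rep := fun p : Projectivization ℂ (Sym2 (Fin 5) → ℂ) => p.rep)
    (Z := detLocus) (p := q) (isWeightedHomogeneous_X ℂ (fun _ => (1 : ℕ)) e')
    (isWeightedHomogeneous_X ℂ (fun _ => (1 : ℕ)) e) (by rw [eval_X]; exact he)
  simp only [eval_X] at this
  simp only [Pi.smul_apply, smul_eq_mul, inv_mul_eq_div]
  exact this

/-- The adjugate in affine coordinates on `𝓗`. -/
theorem regAt_adjugate {q : H.Pt} {e : Sym2 (Fin 5)} (he : coordH q e ≠ 0) (j k : Fin 5) :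
    H.RegAt (fun y => (symMatrix ((coordH y e)⁻¹ • coordH y)).adjugate j k) q := by
  have h2 := regAt_eval (regAt_affineH he) ((genericSymm ℂ (id : Sym2 (Fin 5) → _)).adjugate j k)
  have h3 : ∀ a : Sym2 (Fin 5) → ℂ, eval a ((genericSymm ℂ (id : Sym2 (Fin 5) → _)).adjugate j k) =
      (symMatrix a).adjugate j k := by
    intro a
    have h5 : (eval a).mapMatrix (genericSymm ℂ id) = symMatrix a := by
      ext j k
      exact eval_X _
    have h4 := (eval a).map_adjugate (genericSymm ℂ id)
    rw [h5] at h4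
    rw [← h4, RingHom.mapMatrix_apply, Matrix.map_apply]
  simp only [h3] at h2
  exact h2

theorem adjugate_symMatrix_smul (c : ℂ) (a : Sym2 (Fin 5) → ℂ) (j k : Fin 5) :
    (symMatrix (c • a)).adjugate j k = c ^ 4 * (symMatrix a).adjugate j k := by
  rw [symMatrix_smul, Matrix.adjugate_smul]
  simp

theorem adjugate_smul_ne_zero_iff {q : H.Pt} {e : Sym2 (Fin 5)} (he : coordH q e ≠ 0)
    (j k : Fin 5) : (symMatrix ((coordH q e)⁻¹ • coordH q)).adjugate j k ≠ 0 ↔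
      (symMatrix (coordH q)).adjugate j k ≠ 0 := by
  rw [adjugate_symMatrix_smul]
  simp [he]

theorem isOpen_adjugate_ne_zero (j : Fin 5) :
    IsOpen {q : H.Pt | (symMatrix (coordH q)).adjugate j j ≠ 0} := by
  refine isOpen_iff_eventually.2 fun q hq => ?_
  obtain ⟨e, he⟩ := Function.ne_iff.1 (coordH_ne_zero q)
  filter_upwards [H.ne_zero_eventually (regAt_adjugate he j j)
    ((adjugate_smul_ne_zero_iff he j j).2 hq), eventually_coordH_ne_zero he] with y h1 h2
  exact (adjugate_smul_ne_zero_iff h2 j j).1 h1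

/-- Since `A * adj A = 0`, the nonzero column `j` of the adjugate is a kernel vector depending
polynomially on `A`; pairing it with `A` inverts `π₂` where the cofactor is nonzero. -/
theorem isLocalIsoAt_of_adjugate_ne_zero {p : U.Pt} {j : Fin 5}
    (hp : (symMatrix (coordA p)).adjugate j j ≠ 0) : IsLocalIsoAt π₂ p := by
  classical
  let W : Set H.Pt := {q | (symMatrix (coordH q)).adjugate j j ≠ 0}
  have hW : IsOpen W := isOpen_adjugate_ne_zero j
  have hψ : ∀ q : H.Pt, ∃ r : U.Pt, q ∈ W → π₂.toFun r = q ∧ ∃ c : ℂ, c ≠ 0 ∧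
      coordX r = c • fun k => (symMatrix (coordH q)).adjugate k j := by
    intro q
    by_cases hq : q ∈ W
    · have h0 : (fun k => (symMatrix (coordH q)).adjugate k j) ≠ 0 := fun h => hq (congrFun h j)
      have h1 : (symMatrix (coordH q)).mulVec (fun k => (symMatrix (coordH q)).adjugate k j) = 0 := by
        ext k
        have := congrFun (congrFun (symMatrix (coordH q)).mul_adjugate k) j
        rw [det_coordH, zero_smul] at this
        exact this
      obtain ⟨r, hr, d, -, hd⟩ := exists_point h0 (coordH_ne_zero q) h1
      exact ⟨r, fun _ => ⟨pointH_ext hd, hr⟩⟩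
    -- Outside `W` the value is irrelevant, and `p` serves as a default.
    · exact ⟨p, fun h => absurd h hq⟩
  choose ψ hψ using hψ
  have hc : ∀ q ∈ W, coordA (ψ q) = coordH q := fun q hq => congrArg coordH (hψ q hq).1
  refine ⟨π₂.toFun ⁻¹' W, W, ψ, ?_, hW, hp, fun _ h => h, fun q hq => ?_, ⟨fun r hr => ?_,
    fun q hq => (hψ q hq).1⟩, fun q hq => ?_⟩
  · exact (continuous_iff_continuousAt.2 fun x => (π₂.isMorphismAt x).1).isOpen_preimage _ hW
  · change π₂.toFun (ψ q) ∈ W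
    rwa [(hψ q hq).1]
  · obtain ⟨h1, c, hc0, hcx⟩ := hψ _ hr
    -- Column `j` of the adjugate is `adj j j / x j` times the kernel vector `x`.
    refine point_ext (c := c * (symMatrix (coordA r)).adjugate j j * (coordX r j)⁻¹) ?_ h1
    have key := fun k => Matrix.mul_adjugate_eq_of_mulVec_eq_zero (mulVec_coord r)
      (coordX_ne_zero r) k j j
    have hj : coordX r j ≠ 0 := by
      intro hj
      refine coordX_ne_zero r (funext fun k => ?_)
      have := key k
      rw [hj, zero_mul] at this
      exact (mul_eq_zero.1 this.symm).resolve_right hr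
    rw [hcx]
    ext k
    have := key k
    change c * (symMatrix (coordA r)).adjugate k j =
      c * (symMatrix (coordA r)).adjugate j j * (coordX r j)⁻¹ * coordX r k
    field_simp
    linear_combination this
  · obtain ⟨e, he⟩ := Function.ne_iff.1 (coordH_ne_zero q)
    have hj : ∀ z ∈ W, coordX (ψ z) j ≠ 0 := by
      intro z hz
      obtain ⟨-, c, hc0, hcx⟩ := hψ z hz
      rw [hcx]
      exact mul_ne_zero hc0 hz
    refine isMorphismAt_of_affine (i := j) (e := e) ?_ ?_ ?_
    · filter_upwards [hW.mem_nhds hq] with z hz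
      exact hj z hz
    · filter_upwards [hW.mem_nhds hq, eventually_coordH_ne_zero he] with z hz h
      rwa [hc z hz]
    · rintro (k | e')
      · refine H.regAt_congr ?_ (regAt_div (regAt_adjugate he k j) (regAt_adjugate he j j)
          ((adjugate_smul_ne_zero_iff he j j).2 hq))
        filter_upwards [hW.mem_nhds hq, eventually_coordH_ne_zero he] with z hz h
        obtain ⟨-, c, hc0, hcx⟩ := hψ z hz
        have hz' : (symMatrix (coordH z)).adjugate j j ≠ 0 := hz
        simp only [adjugate_symMatrix_smul, affine, hcx, Sum.elim_inl, Pi.smul_apply, smul_eq_mul]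
        field_simp
      · refine H.regAt_congr ?_ (regAt_affineH he e')
        filter_upwards [hW.mem_nhds hq] with z hz
        simp only [affine, hc z hz, Sum.elim_inr]

/-- With a second kernel vector `w`, all points `x + t w` lie over the same matrix. A Zariski
neighbourhood of `p` contains some of them with `t ≠ 0`, so `π₂` is not injective on it. -/
theorem not_isLocalIsoAt_of_adjugate_eq_zero {p : U.Pt} {i : Fin 5} (hi : coordX p i ≠ 0)
    (h0 : (symMatrix (coordA p)).adjugate i i = 0) : ¬ IsLocalIsoAt π₂ p := by
  rintro ⟨V, W, ψ, hV, -, hp, -, -, hinv, -⟩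
  obtain ⟨w, hw, hwi, hAw⟩ := Matrix.exists_mulVec_eq_zero_of_adjugate_eq_zero
    (isSymm_symMatrix _) (mulVec_coord p) hi h0
  obtain ⟨F, m, hm, hF, hFV⟩ := eventually_iff.1 (hV.mem_nhds hp)
  -- The restriction to the line `x + t w` of the polynomial `F` that defines a neighbourhood inside
  -- `V`.
  let Q : Polynomial ℂ := aeval (Sum.elim
    (fun k => Polynomial.C (coordX p k) + Polynomial.X * Polynomial.C (w k))
    (fun e => Polynomial.C (coordA p e))) F
  have hQ : ∀ t, Q.eval t = eval (Sum.elim (coordX p + t • w) (coordA p)) F := by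
    intro t
    change Polynomial.evalRingHom t (aeval _ F) = _
    simp only [MvPolynomial.aeval_def, MvPolynomial.hom_eval₂]
    refine congrArg₂ (fun f g => eval₂ f g F) (RingHom.ext fun c => Polynomial.eval_C)
      (funext fun n => ?_)
    cases n with
    | inl k =>
      change Polynomial.eval t (_ + _ * _) = coordX p k + t * w k
      rw [Polynomial.eval_add, Polynomial.eval_mul, Polynomial.eval_C, Polynomial.eval_C,
        Polynomial.eval_X]
    | inr e => exact Polynomial.eval_C
  -- The factor `X` forces the chosen parameter `t` to be nonzero.
  have hX : Q * Polynomial.X ≠ 0 := by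
    refine mul_ne_zero (fun h => hF ?_) Polynomial.X_ne_zero
    have := hQ 0
    rw [h] at this
    simpa using this.symm
  obtain ⟨t, ht⟩ : ∃ t, (Q * Polynomial.X).eval t ≠ 0 := by
    by_contra! h
    exact hX (Polynomial.funext fun t => by simpa using h t)
  rw [Polynomial.eval_mul, Polynomial.eval_X, hQ] at ht
  have hx : (coordX p + t • w) i = coordX p i := by simp [hwi]
  have hx0 : coordX p + t • w ≠ 0 := fun h => hi (by rw [← hx, h]; rfl)
  obtain ⟨r, ⟨c, hc0, hc⟩, d, hd0, hd⟩ := exists_point hx0 (coordH_ne_zero (π₂.toFun p)) (by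
    have h1 := mulVec_coord p
    rw [coordA] at h1 hAw
    rw [Matrix.mulVec_add, Matrix.mulVec_smul, h1, hAw, smul_zero, add_zero])
  have hr : r ∈ V := by
    refine hFV r ?_
    rw [coord, hc, hd, eval_smul_of_bihomogeneous hm]
    exact mul_ne_zero (mul_ne_zero (pow_ne_zero _ hc0) (pow_ne_zero _ hd0)) (left_ne_zero_of_mul ht)
  have hπ : π₂.toFun r = π₂.toFun p := pointH_ext hd
  have hrp : r = p := by rw [← hinv.1 hr, ← hinv.1 hp, hπ]
  rw [hrp] at hc
  -- As `w i = 0`, the coordinate `i` is constant along the line; comparing it gives scaling factor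
  -- 1, hence `t w = 0`.
  have h1 := congrFun hc i
  rw [Pi.smul_apply, hx, smul_eq_mul] at h1
  have hc1 : c = 1 := mul_right_cancel₀ hi (by rw [← h1, one_mul])
  rw [hc1, one_smul, left_eq_add] at hc
  exact hw ((smul_eq_zero.1 hc).resolve_left (right_ne_zero_of_mul ht))

theorem mem_E_iff {p : U.Pt} {i : Fin 5} (hi : coordX p i ≠ 0) :
    p ∈ E ↔ (symMatrix (coordA p)).adjugate i i = 0 :=
  ⟨fun h => by_contra fun h0 => h (isLocalIsoAt_of_adjugate_ne_zero h0),
    fun h => not_isLocalIsoAt_of_adjugate_eq_zero hi h⟩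

end SymmetricDeterminantal

namespace SymmetricDeterminantal

open SpaceWithFunctions MvPolynomial

/-! ## The parametrisation of the charts -/

section Parametrisation

variable {R S : Type*} [CommRing R] [CommRing S]

/-- The projection of a symmetric matrix `a` to the matrices with kernel vector `x`, where
`x i = 1`: the matrix is unchanged outside the row and the column `i`. -/
def projEntry (i : Fin 5) (x : Fin 5 → R) (a : Sym2 (Fin 5) → R) : Sym2 (Fin 5) → R :=
  Sym2.lift ⟨fun j k => a s(j, k) - (if k = i then ∑ l, a s(j, l) * x l else 0) -
    (if j = i then ∑ l, a s(k, l) * x l else 0) +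
    (if j = i ∧ k = i then ∑ l, x l * ∑ l', a s(l, l') * x l' else 0), fun j k => by
      simp only [Sym2.eq_swap (a := k), and_comm (a := k = i)]
      ring⟩

theorem projEntry_mk (i : Fin 5) (x : Fin 5 → R) (a : Sym2 (Fin 5) → R) (j k : Fin 5) :
    projEntry i x a s(j, k) = a s(j, k) - (if k = i then ∑ l, a s(j, l) * x l else 0) -
      (if j = i then ∑ l, a s(k, l) * x l else 0) +
        (if j = i ∧ k = i then ∑ l, x l * ∑ l', a s(l, l') * x l' else 0) :=
  rfl

theorem map_projEntry (f : R →+* S) (i : Fin 5) (x : Fin 5 → R) (a : Sym2 (Fin 5) → R)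
    (e : Sym2 (Fin 5)) :
    f (projEntry i x a e) = projEntry i (fun j => f (x j)) (fun e => f (a e)) e := by
  induction e with | _ j k
  simp only [projEntry_mk, map_add, map_sub, apply_ite f, map_sum, map_mul, map_zero]

theorem projEntry_succAbove (i : Fin 5) (x : Fin 5 → R) (a : Sym2 (Fin 5) → R)
    (e : Sym2 (Fin 4)) :
    projEntry i x a (e.map i.succAbove) = a (e.map i.succAbove) := by
  induction e with | _ j k
  simp [projEntry_mk, Fin.succAbove_ne]

/-- In matrix terms `projEntry` is `Pᵀ A P` with `P = 1 - x e_iᵀ`, and `P x = 0` because `x i = 1`.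
-/
theorem sum_projEntry_mul {i : Fin 5} {x : Fin 5 → R} (hx : x i = 1) (a : Sym2 (Fin 5) → R)
    (j : Fin 5) : ∑ k, projEntry i x a s(j, k) * x k = 0 := by
  have h1 : ∀ k, projEntry i x a s(j, k) * x k = a s(j, k) * x k -
      (if k = i then (∑ l, a s(j, l) * x l) * x i else 0) -
      (if j = i then x k * ∑ l, a s(k, l) * x l else 0) +
      (if k = i then (if j = i then (∑ l, x l * ∑ l', a s(l, l') * x l') * x i else 0) else 0) := by
    intro k
    rw [projEntry_mk]
    by_cases hk : k = i <;> by_cases hj : j = i <;> simp [hk, hj] <;> ring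
  simp only [h1, Finset.sum_add_distrib, Finset.sum_sub_distrib, Finset.sum_ite_eq',
    Finset.mem_univ, if_true, hx, mul_one, sub_self]
  by_cases hj : j = i <;> simp [hj]

/-- Every correction term contains an entry of `A x`. -/
theorem projEntry_eq_self {i : Fin 5} {x : Fin 5 → R} {a : Sym2 (Fin 5) → R}
    (h : ∀ j, ∑ l, a s(j, l) * x l = 0) : projEntry i x a = a := by
  ext e
  induction e with | _ j k
  simp [projEntry_mk, h]

/-- The parametrisation of the chart `x i ≠ 0` by unrestricted coordinates. -/
def param (i : Fin 5) (s : Fin 5 ⊕ Sym2 (Fin 5) → R) : Fin 5 ⊕ Sym2 (Fin 5) → R :=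
  Sum.elim (Function.update (s ∘ Sum.inl) i 1)
    (projEntry i (Function.update (s ∘ Sum.inl) i 1) (s ∘ Sum.inr))

theorem map_param (f : R →+* S) (i : Fin 5) (s : Fin 5 ⊕ Sym2 (Fin 5) → R)
    (n : Fin 5 ⊕ Sym2 (Fin 5)) : f (param i s n) = param i (fun n => f (s n)) n := by
  have h : ∀ j, f (Function.update (s ∘ Sum.inl) i 1 j) =
      Function.update ((fun n => f (s n)) ∘ Sum.inl) i 1 j := by
    intro j
    by_cases hj : j = i
    · subst hj
      simp
    · simp [hj]
  cases n with
  | inl j => exact h j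
  | inr e =>
    simp only [param, Sum.elim_inr, map_projEntry, h]
    rfl

end Parametrisation

/-- `bind₁ (param i X)` is pull-back along the parametrisation; it turns statements on the chart
into statements about polynomials in free variables. -/
theorem eval_bind₁_param (i : Fin 5) (F : MvPolynomial (Fin 5 ⊕ Sym2 (Fin 5)) ℂ)
    (s : Fin 5 ⊕ Sym2 (Fin 5) → ℂ) :
    eval s (bind₁ (param i X) F) = eval (param i s) F := by
  rw [eval, eval₂Hom_bind₁]
  refine congrArg (fun g => eval g F) (funext fun n => ?_)
  have := map_param (eval s) i (X : _ → MvPolynomial (Fin 5 ⊕ Sym2 (Fin 5)) ℂ) n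
  simp only [eval_X] at this
  exact this

/-! ### The principal minor in the parametrised chart. -/

/-- The variables of the principal minor that omits the index `i`. -/
def minorVar (i : Fin 5) : Sym2 (Fin 4) → Fin 5 ⊕ Sym2 (Fin 5) :=
  Sum.inr ∘ Sym2.map i.succAbove

theorem minorVar_injective (i : Fin 5) : Function.Injective (minorVar i) :=
  Sum.inr_injective.comp (Sym2.map.injective Fin.succAbove_right_injective)

/-- The principal minor that omits the index `i`. -/
noncomputable abbrev minor (i : Fin 5) : MvPolynomial (Fin 5 ⊕ Sym2 (Fin 5)) ℂ :=
  (genericSymm ℂ (minorVar i)).det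

theorem eval_minor (i : Fin 5) (s : Fin 5 ⊕ Sym2 (Fin 5) → ℂ) :
    eval s (minor i) = (symMatrix (s ∘ Sum.inr)).adjugate i i := by
  rw [eval_det_genericSymm, Matrix.adjugate_apply_self_eq_det_submatrix]
  rfl

theorem param_minorVar (i : Fin 5) (s : Fin 5 ⊕ Sym2 (Fin 5) → ℂ) (e : Sym2 (Fin 4)) :
    param i s (minorVar i e) = s (minorVar i e) :=
  projEntry_succAbove i _ _ e

theorem eval_param_minor (i : Fin 5) (s : Fin 5 ⊕ Sym2 (Fin 5) → ℂ) :
    eval (param i s) (minor i) = eval s (minor i) := by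
  rw [eval_det_genericSymm, eval_det_genericSymm]
  simp only [param_minorVar]

/-- Affine coordinates of a point of `𝓤` already satisfy `x i = 1` and `A x = 0`. So pulling a
polynomial back along `param` does not change its values on the chart. -/
theorem param_affine {i : Fin 5} {p : U.Pt} (hi : coordX p i ≠ 0) (e : Sym2 (Fin 5)) :
    param i (affine i e p) = affine i e p := by
  have h1 : Function.update (affine i e p ∘ Sum.inl) i 1 = affine i e p ∘ Sum.inl :=
    Function.update_eq_self_iff.2 (by simp [affine, hi])
  have h2 : projEntry i (affine i e p ∘ Sum.inl) (affine i e p ∘ Sum.inr) =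
      affine i e p ∘ Sum.inr := by
    refine projEntry_eq_self fun j => ?_
    have h3 := congrFun (mulVec_coord p) j
    have h4 : ∀ l, (affine i e p ∘ Sum.inr) s(j, l) * (affine i e p ∘ Sum.inl) l =
        (coordA p e)⁻¹ * (coordX p i)⁻¹ * (symMatrix (coordA p) j l * coordX p l) := by
      intro l
      simp only [affine, Function.comp_apply, Sum.elim_inr, Sum.elim_inl, Pi.smul_apply,
        smul_eq_mul, symMatrix, Matrix.of_apply]
      ring
    simp only [h4, ← Finset.mul_sum]
    rw [show ∑ l, symMatrix (coordA p) j l * coordX p l = 0 from h3, mul_zero]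
  rw [param, h1, h2, Sum.elim_comp_inl_inr]

/-- The parametrisation has values in `𝓤`. -/
theorem exists_point_param {i : Fin 5} {s : Fin 5 ⊕ Sym2 (Fin 5) → ℂ} {e : Sym2 (Fin 4)}
    (he : s (minorVar i e) ≠ 0) : ∃ r : U.Pt, (r ∈ E ↔ eval s (minor i) = 0) ∧
      ∀ (F : MvPolynomial (Fin 5 ⊕ Sym2 (Fin 5)) ℂ) (m : ℕ × ℕ),
        F.IsWeightedHomogeneous biWeight m → (eval (coord r) F = 0 ↔ eval (param i s) F = 0) := by
  have hx : (param i s ∘ Sum.inl) i = 1 := Function.update_self i 1 (s ∘ Sum.inl)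
  -- Both coordinate vectors are nonzero: the first has entry 1 at `i`, and the second keeps the
  -- nonzero entry `e` of the block.
  obtain ⟨r, ⟨c, hc0, hc⟩, d, hd0, hd⟩ := exists_point (x := param i s ∘ Sum.inl)
    (a := param i s ∘ Sum.inr) (fun h => one_ne_zero (hx.symm.trans (congrFun h i)))
    (fun h => he (by rw [← param_minorVar i s e]; exact congrFun h (e.map i.succAbove)))
    (funext fun j => sum_projEntry_mul (by simp) _ j)
  refine ⟨r, ?_, fun F m hF => ?_⟩
  · have hi : coordX r i ≠ 0 := by
      rw [hc, Pi.smul_apply, hx]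
      exact mul_ne_zero hc0 one_ne_zero
    rw [mem_E_iff hi, hd, adjugate_symMatrix_smul, ← eval_minor, eval_param_minor]
    simp [hd0]
  · rw [coord, hc, hd, eval_smul_of_bihomogeneous hF, Sum.elim_comp_inl_inr]
    simp [hc0, hd0]

/-- Parameters with zero block define no point of `ℙ¹⁴`; a nonzero `3 × 3` minor rules them out,
which is why vanishing in `det_genericSymm_dvd` is required only where that minor is nonzero. -/
theorem exists_minorVar_ne_zero {i : Fin 5} {s : Fin 5 ⊕ Sym2 (Fin 5) → ℂ}
    (h : eval s (genericMinor ℂ (minorVar i)) ≠ 0) : ∃ e, s (minorVar i e) ≠ 0 := by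
  by_contra! h0
  refine h ?_
  rw [eval_det_genericSymm]
  simp only [Function.comp_apply, h0]
  exact Matrix.det_zero

/-! ### The minor as a local equation of the exceptional locus. -/

theorem eval_affine_minor (i : Fin 5) (e : Sym2 (Fin 5)) (p : U.Pt) :
    eval (affine i e p) (minor i) =
      (coordA p e)⁻¹ ^ 4 * (symMatrix (coordA p)).adjugate i i := by
  rw [eval_minor, ← adjugate_symMatrix_smul]
  rfl

/-- Regular functions on a small neighbourhood, as quotients of polynomials. -/
theorem exists_local_form {p : U.Pt} {i : Fin 5} {e : Sym2 (Fin 5)} (hi : coordX p i ≠ 0)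
    (he : coordA p e ≠ 0) {h : U.Pt → ℂ} (hh : U.RegAt h p) {P : U.Pt → Prop}
    (hP : ∀ᶠ y in 𝓝 p, P y) :
    ∃ (F G K : MvPolynomial (Fin 5 ⊕ Sym2 (Fin 5)) ℂ) (m n : ℕ × ℕ),
      F.IsWeightedHomogeneous biWeight m ∧ G.IsWeightedHomogeneous biWeight m ∧
        K.IsWeightedHomogeneous biWeight n ∧ eval (coord p) K ≠ 0 ∧
          ∀ y : U.Pt, eval (coord y) K ≠ 0 → P y ∧ coordX y i ≠ 0 ∧ coordA y e ≠ 0 ∧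
            eval (coord y) G ≠ 0 ∧ h y = eval (coord y) F / eval (coord y) G := by
  obtain ⟨F, G, m, hF, hG, h0, hFG⟩ := exists_eq_div hh
  have hG' : ∀ᶠ y in 𝓝 p, eval (coord y) G ≠ 0 := eventually_iff.2 ⟨G, m, hG, h0, fun _ h => h⟩
  obtain ⟨K, n, hK, hK0, hall⟩ := eventually_iff.1 (hP.and ((eventually_coordX_ne_zero hi).and
    ((eventually_coordA_ne_zero he).and (hG'.and hFG))))
  exact ⟨F, G, K, m, n, hF, hG, hK, hK0, hall⟩

/-- The principal minor that omits `i` is a local equation of the exceptional locus on the chart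
`x i ≠ 0`. -/
theorem generatesIdealAt_minor {p : U.Pt} {i : Fin 5} {e : Sym2 (Fin 5)} (hi : coordX p i ≠ 0)
    (he : coordA p e ≠ 0) : GeneratesIdealAt E (fun y => eval (affine i e y) (minor i)) p := by
  have hreg := fun F => regAt_eval (regAt_affine hi he) F
  have hbind : ∀ (F : MvPolynomial (Fin 5 ⊕ Sym2 (Fin 5)) ℂ) (y : U.Pt), coordX y i ≠ 0 →
      eval (affine i e y) (bind₁ (param i X) F) = eval (affine i e y) F := by
    intro F y hy
    rw [eval_bind₁_param, param_affine hy]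
  refine ⟨hreg _, fun h hh => ⟨fun hz => ?_, ?_⟩, fun q hq hz => ?_⟩
  · obtain ⟨F, G, K, m, n, hF, hG, hK, hK0, hall⟩ := exists_local_form hi he hh hz
    -- The vanishing of `h = F / G` on `E` is known only where `K ≠ 0`; the factor `K` extends it to
    -- all parameters.
    have hdvd : minor i ∣ bind₁ (param i X) (F * K) := by
      refine det_genericSymm_dvd (minorVar_injective i) fun s hs hs' => ?_
      obtain ⟨e', he'⟩ := exists_minorVar_ne_zero hs'
      obtain ⟨r, hrE, hr⟩ := exists_point_param he'
      rw [eval_bind₁_param, map_mul]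
      by_cases hKr : eval (coord r) K = 0
      · rw [(hr K n hK).1 hKr, mul_zero]
      · obtain ⟨h1, -, -, h4, h5⟩ := hall r hKr
        rw [h1 (hrE.2 hs), eq_comm, div_eq_zero_iff, or_iff_left h4] at h5
        rw [(hr F m hF).1 h5, zero_mul]
    obtain ⟨Q, hQ⟩ := hdvd
    have hGK := hG.mul hK
    -- On the chart `F * K` equals the minor times `Q`, so `h = F * K / (G * K)` is the minor times
    -- `Q / (G * K)`.
    refine ⟨fun y => eval (affine i e y) Q / eval (affine i e y) (G * K),
      regAt_div (hreg Q) (hreg _) ?_, ?_⟩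
    · rw [Ne, eval_affine_eq_zero_iff hGK hi he, map_mul]
      exact mul_ne_zero (hall p hK0).2.2.2.1 hK0
    · refine eventually_iff.2 ⟨K, n, hK, hK0, fun y hy => ?_⟩
      obtain ⟨-, h2, h3, h4, h5⟩ := hall y hy
      have h6 := hbind (F * K) y h2
      rw [hQ, map_mul] at h6
      have h7 := (eval_affine_eq_zero_iff hK h2 h3).not.2 hy
      rw [h5, ← eval_affine_div hF hG h2 h3, div_mul_eq_mul_div, mul_comm (eval _ Q), h6,
        map_mul, map_mul, mul_div_mul_right _ _ h7]
  · rintro ⟨q, hq, hqf⟩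
    filter_upwards [hqf, eventually_coordX_ne_zero hi] with y hy hyi hyE
    rw [hy, eval_affine_minor, (mem_E_iff hyi).1 hyE, mul_zero, mul_zero]
  · obtain ⟨F, G, K, m, n, hF, hG, hK, hK0, hall⟩ := exists_local_form hi he hq hz
    -- Off `E` the minor can be cancelled, so `q`, and with it `F`, vanishes where `K ≠ 0`. The
    -- other factors absorb the remaining parameters; they are nonzero polynomials, so the pull-back
    -- of `F` is zero.
    have hprod : bind₁ (param i X) F * bind₁ (param i X) K *
        (minor i * genericMinor ℂ (minorVar i)) = 0 := by
      refine MvPolynomial.funext fun s => ?_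
      rw [map_mul, map_mul, map_mul, map_zero, eval_bind₁_param, eval_bind₁_param]
      by_cases hs' : eval s (genericMinor ℂ (minorVar i)) = 0
      · rw [hs', mul_zero, mul_zero]
      obtain ⟨e', he'⟩ := exists_minorVar_ne_zero hs'
      obtain ⟨r, hrE, hr⟩ := exists_point_param he'
      by_cases hKr : eval (coord r) K = 0
      · rw [(hr K n hK).1 hKr, mul_zero, zero_mul]
      obtain ⟨h1, h2, h3, h4, h5⟩ := hall r hKr
      by_cases hs : eval s (minor i) = 0
      · rw [hs, zero_mul, mul_zero]
      have h6 : eval (affine i e r) (minor i) ≠ 0 := by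
        rw [eval_affine_minor]
        exact mul_ne_zero (pow_ne_zero _ (inv_ne_zero h3))
          (fun h => hs (hrE.1 ((mem_E_iff h2).2 h)))
      rw [(mul_eq_zero.1 h1).resolve_right h6, eq_comm, div_eq_zero_iff, or_iff_left h4] at h5
      rw [(hr F m hF).1 h5, zero_mul, zero_mul]
    have hvs : Function.Injective (minorVar i ∘ Sym2.map (Fin.succ : Fin 3 → Fin 4)) :=
      (minorVar_injective i).comp (Sym2.map.injective (Fin.succ_injective 3))
    have hK' : bind₁ (param i X) K ≠ 0 := by
      intro h
      have := hbind K p hi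
      rw [h, map_zero] at this
      exact hK0 ((eval_affine_eq_zero_iff hK hi he).1 this.symm)
    have hF' : bind₁ (param i X) F = 0 :=
      (mul_eq_zero.1 ((mul_eq_zero.1 hprod).resolve_right (mul_ne_zero
        (det_genericSymm_ne_zero (minorVar_injective i))
        (det_genericSymm_ne_zero hvs)))).resolve_right hK'
    refine eventually_iff.2 ⟨K, n, hK, hK0, fun y hy => ?_⟩
    obtain ⟨-, h2, h3, h4, h5⟩ := hall y hy
    have h6 := hbind F y h2
    rw [hF', map_zero, eq_comm, eval_affine_eq_zero_iff hF h2 h3] at h6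
    rw [h5, h6, zero_div]

end SymmetricDeterminantal

namespace SymmetricDeterminantal

open SpaceWithFunctions MvPolynomial

/-! ## The class of the exceptional divisor -/

theorem isReducedDivisor_E : IsReducedDivisor E := by
  intro p
  obtain ⟨i, hi⟩ := exists_coordX_ne_zero p
  obtain ⟨e, he⟩ := exists_coordA_ne_zero p
  refine ⟨{y | coordX y i ≠ 0 ∧ coordA y e ≠ 0}, fun y => eval (affine i e y) (minor i),
    isOpen_iff_eventually.2 fun y hy => ?_, ⟨hi, he⟩,
    fun y hy => generatesIdealAt_minor hy.1 hy.2⟩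
  exact (eventually_coordX_ne_zero hy.1).and (eventually_coordA_ne_zero hy.2)

/-- The line bundle `𝓛`. -/
noncomputable abbrev bundleL : LineBundle U := (hyperplaneBundle (Fin 5)).pullback π₁

/-- The line bundle `𝓜`. -/
noncomputable abbrev bundleM : LineBundle U := hyperplaneBundleH.pullback π₂

/-- The line bundle `𝓜 ^ 4 ⊗ 𝓛 ^ (-2)`. -/
noncomputable abbrev bundleE : LineBundle U :=
  (((bundleM.tensor bundleM).tensor bundleM).tensor bundleM).tensor (bundleL.tensor bundleL).dual

theorem toPic_bundleE : bundleE.toPic = 4 • classM - 2 • classL := by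
  -- This bracketing matches `bundleE`, so its class is the right-hand side by definition.
  have h : 4 • classM - 2 • classL =
      (((classM + classM) + classM) + classM) + -(classL + classL) := by abel
  rw [h]
  rfl

theorem adjugate_symm (p : U.Pt) (j k : Fin 5) :
    (symMatrix (coordA p)).adjugate j k = (symMatrix (coordA p)).adjugate k j := by
  have h := Matrix.adjugate_transpose (symMatrix (coordA p))
  rw [(isSymm_symMatrix _).eq] at h
  exact congrFun (congrFun h k) j

/-- The adjugate is a multiple of `x xᵀ`: proportionality of its columns to `x` is applied twice,
the second time through symmetry. -/
theorem mul_mul_adjugate_eq (p : U.Pt) (i j k l : Fin 5) :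
    coordX p k * coordX p l * (symMatrix (coordA p)).adjugate i j =
      coordX p i * coordX p j * (symMatrix (coordA p)).adjugate k l := by
  have h1 := Matrix.mul_adjugate_eq_of_mulVec_eq_zero (mulVec_coord p) (coordX_ne_zero p) i j k
  have h2 := Matrix.mul_adjugate_eq_of_mulVec_eq_zero (mulVec_coord p) (coordX_ne_zero p) j k l
  rw [adjugate_symm p j k, adjugate_symm p l k] at h2
  linear_combination coordX p l * h1 + coordX p i * h2

/-- The section of `𝓜 ^ 4 ⊗ 𝓛 ^ (-2)` given by the adjugate matrix. -/
noncomputable def adjugateSection (n : bundleE.ι) (p : U.Pt) : ℂ :=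
  (symMatrix (coordA p)).adjugate n.2.1 n.2.2 /
    (coordA p n.1.1.1.1 * coordA p n.1.1.1.2 * coordA p n.1.1.2 * coordA p n.1.2)

/-- The four denominators account for `𝓜 ^ 4`, and the rank-one relation `mul_mul_adjugate_eq` for
`𝓛 ^ (-2)`. -/
theorem adjugateSection_eq (n n' : bundleE.ι) (p : U.Pt) (hp : p ∈ bundleE.V n ∩ bundleE.V n') :
    adjugateSection n p = bundleE.g n n' p * adjugateSection n' p := by
  obtain ⟨⟨⟨⟨e₁, e₂⟩, e₃⟩, e₄⟩, i₁, i₂⟩ := n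
  obtain ⟨⟨⟨⟨f₁, f₂⟩, f₃⟩, f₄⟩, k₁, k₂⟩ := n'
  obtain ⟨⟨⟨⟨⟨a₁, a₂⟩, a₃⟩, a₄⟩, x₁, x₂⟩, ⟨⟨⟨b₁, b₂⟩, b₃⟩, b₄⟩, y₁, y₂⟩ := hp
  change coordA p e₁ ≠ 0 at a₁
  change coordA p e₂ ≠ 0 at a₂
  change coordA p e₃ ≠ 0 at a₃
  change coordA p e₄ ≠ 0 at a₄
  change coordA p f₁ ≠ 0 at b₁
  change coordA p f₂ ≠ 0 at b₂
  change coordA p f₃ ≠ 0 at b₃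
  change coordA p f₄ ≠ 0 at b₄
  change coordX p i₁ ≠ 0 at x₁
  change coordX p i₂ ≠ 0 at x₂
  change coordX p k₁ ≠ 0 at y₁
  change coordX p k₂ ≠ 0 at y₂
  have key := mul_mul_adjugate_eq p i₁ i₂ k₁ k₂
  change (symMatrix (coordA p)).adjugate i₁ i₂ /
      (coordA p e₁ * coordA p e₂ * coordA p e₃ * coordA p e₄) =
    coordA p f₁ / coordA p e₁ * (coordA p f₂ / coordA p e₂) * (coordA p f₃ / coordA p e₃) *
      (coordA p f₄ / coordA p e₄) *
      (coordX p k₁ / coordX p i₁ * (coordX p k₂ / coordX p i₂))⁻¹ *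
      ((symMatrix (coordA p)).adjugate k₁ k₂ /
        (coordA p f₁ * coordA p f₂ * coordA p f₃ * coordA p f₄))
  field_simp
  linear_combination key

/-- The function is the affine minor at `i₁` times the unit `(x i₂ / x i₁) * A e₁ ^ 3 / (A e₂ * A e₃
* A e₄)`. -/
theorem generatesIdealAt_adjugate {p : U.Pt} {i₁ i₂ : Fin 5} {e₁ e₂ e₃ e₄ : Sym2 (Fin 5)}
    (x₁ : coordX p i₁ ≠ 0) (x₂ : coordX p i₂ ≠ 0) (a₁ : coordA p e₁ ≠ 0) (a₂ : coordA p e₂ ≠ 0)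
    (a₃ : coordA p e₃ ≠ 0) (a₄ : coordA p e₄ ≠ 0) :
    GeneratesIdealAt E (fun y => (symMatrix (coordA y)).adjugate i₁ i₂ /
      (coordA y e₁ * coordA y e₂ * coordA y e₃ * coordA y e₄)) p := by
  have hne : ∀ e, coordA p e ≠ 0 → affine i₁ e₁ p (Sum.inr e) ≠ 0 := fun e he =>
    mul_ne_zero (inv_ne_zero a₁) he
  have hinv := fun e he => U.regAt_inv (regAt_affine x₁ a₁ (Sum.inr e)) (hne e he)
  refine (generatesIdealAt_minor x₁ a₁).of_eventually_eq_mul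
    (U.regAt_mul (regAt_affine x₁ a₁ (Sum.inl i₂))
      (U.regAt_mul (U.regAt_mul (hinv e₂ a₂) (hinv e₃ a₃)) (hinv e₄ a₄)))
    (mul_ne_zero (mul_ne_zero (inv_ne_zero x₁) x₂) (mul_ne_zero (mul_ne_zero
      (inv_ne_zero (hne e₂ a₂)) (inv_ne_zero (hne e₃ a₃))) (inv_ne_zero (hne e₄ a₄)))) ?_
  filter_upwards [eventually_coordX_ne_zero x₁, eventually_coordA_ne_zero a₁,
    eventually_coordA_ne_zero a₂, eventually_coordA_ne_zero a₃, eventually_coordA_ne_zero a₄]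
    with y h1 h2 h3 h4 h5
  have key := Matrix.mul_adjugate_eq_of_mulVec_eq_zero (mulVec_coord y) (coordX_ne_zero y) i₂ i₁ i₁
  rw [adjugate_symm y i₂ i₁] at key
  rw [eval_affine_minor]
  simp only [affine, Sum.elim_inl, Sum.elim_inr, Pi.smul_apply, smul_eq_mul]
  field_simp
  linear_combination key

theorem generatesIdealAt_adjugateSection (n : bundleE.ι) (p : U.Pt) (hp : p ∈ bundleE.V n) :
    GeneratesIdealAt E (adjugateSection n) p :=
  generatesIdealAt_adjugate hp.2.1 hp.2.2 hp.1.1.1.1 hp.1.1.1.2 hp.1.1.2 hp.1.2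

end SymmetricDeterminantal

theorem mainTheorem6 :
    ∃ hE : SpaceWithFunctions.IsReducedDivisor SymmetricDeterminantal.E,
      hE.lineBundle.toPic =
        4 • SymmetricDeterminantal.classM - 2 • SymmetricDeterminantal.classL := by
  refine ⟨SymmetricDeterminantal.isReducedDivisor_E, ?_⟩
  rw [← SymmetricDeterminantal.toPic_bundleE]
  exact Quotient.sound (SpaceWithFunctions.IsReducedDivisor.nonempty_iso _ _
    SymmetricDeterminantal.adjugateSection
    SymmetricDeterminantal.generatesIdealAt_adjugateSection
    SymmetricDeterminantal.adjugateSection_eq)
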